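/- **Setting.** Let $P$ be the commutative algebra of formal series $\sum_{i\le n}a_i(t)\tau^i$ with $a_i\in\mathbb C[t,t^{-1}]$, let $\Lambda(4)$ be the Grassmann algebra in the odd variables $\xi_1,\xi_2,\eta_1,\eta_2$, and let $P(4)=P\otimes\Lambda(4)$ with the Poisson superbracket $$\{A,B\}=\partial_\tau A\,\partial_tB-\partial_tA\,\partial_\tau B+(-1)^{p(A)+1}\sum_{i=1}^2(\partial_{\xi_i}A\,\partial_{\eta_i}B+\partial_{\eta_i}A\,\partial_{\xi_i}B).$$ Let $K(4)=P_{(2)}(4)\subset P(4)$ be the span of the monomials of total degree $2$, where $t,\tau,\xi_i,\eta_i$ all have degree $1$, and let $K'(4)=[K(4),K(4)]$. For $\sigma_1+\sigma_2+\sigma_3=0$ let $\Gamma(\sigma_1,\sigma_2,\sigma_3)$ be the Lie superalgebra with even part $sp(\psi_1)\oplus sp(\psi_2)\oplus sp(\psi_3)$ and odd part $V_1\otimes V_2\otimes V_3$, where $V_1=\langle e_1,e_2\rangle$, $V_2=\langle f_1,f_2\rangle$, $V_3=\langle h_1,h_2\rangle$ are two-dimensional complex spaces with skew forms $\psi_i$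 taking the value $1$ on the given pair of basis vectors; the even part acts on the odd part by the tensor product of the standard representations, and $$[x_1\otimes x_2\otimes x_3,\;y_1\otimes y_2\otimes y_3]=\sum_{i}\sigma_i\,\psi_j(x_j,y_j)\psi_k(x_k,y_k)\,\mathcal P_i(x_i,y_i),\qquad \{i,j,k\}=\{1,2,3\},$$ where $\mathcal P_i(x,y)z=\psi_i(y,z)x-\psi_i(z,x)y$. For $\alpha\in\mathbb C$ let $\rho_\alpha:\Gamma(2,-1-\alpha,\alpha-1)\to P(4)$ be the linear map given by $$\begin{aligned} &\mathcal P_1(e_1,e_1)\mapsto -E^1_\alpha,\quad \mathcal P_1(e_2,e_2)\mapsto -F^1_\alpha,\quad \mathcal P_1(e_1,e_2)\mapsto -H^1_\alpha,\\ &\mathcal P_2(f_1,f_1)\mapsto -2F^2_\alpha,\quad \mathcal P_2(f_2,f_2)\mapsto -2E^2_\alpha,\quad \mathcal P_2(f_1,f_2)\mapsto H^2_\alpha,\\ &\mathcal P_3(h_1,h_1)\mapsto -2F^3_\alpha,\quad \mathcal P_3(h_2,h_2)\mapsto 2E^3_\alpha,\quad \mathcal P_3(h_1,h_2)\mapsto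 H^3_\alpha,\\ &e_1\otimes f_1\otimes h_1\mapsto \sqrt2\,i\,T^1_\alpha,\quad e_1\otimes f_1\otimes h_2\mapsto \sqrt2\,i\,T^2_\alpha,\quad e_1\otimes f_2\otimes h_1\mapsto -\sqrt2\,i\,T^4_\alpha,\quad e_1\otimes f_2\otimes h_2\mapsto \sqrt2\,i\,T^3_\alpha,\\ &e_2\otimes f_1\otimes h_1\mapsto \sqrt2\,i\,D^3_\alpha,\quad e_2\otimes f_1\otimes h_2\mapsto \sqrt2\,i\,D^4_\alpha,\quad e_2\otimes f_2\otimes h_1\mapsto -\sqrt2\,i\,D^2_\alpha,\quad e_2\otimes f_2\otimes h_2\mapsto \sqrt2\,i\,D^1_\alpha, \end{aligned}$$ where $$\begin{aligned} &E^1_\alpha=t^2,\quad F^1_\alpha=\tau^2-2\alpha t^{-2}\xi_1\xi_2\eta_1\eta_2,\quad H^1_\alpha=t\tau,\\ &E^2_\alpha=\xi_1\xi_2,\quad F^2_\alpha=\eta_1\eta_2,\quad H^2_\alpha=\xi_1\eta_1+\xi_2\eta_2,\\ &E^3_\alpha=\xi_1\eta_2,\quad F^3_\alpha=\xi_2\eta_1,\quad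 H^3_\alpha=\xi_1\eta_1-\xi_2\eta_2,\\ &T^1_\alpha=t\eta_1,\quad T^2_\alpha=t\eta_2,\quad T^3_\alpha=t\xi_1,\quad T^4_\alpha=t\xi_2,\\ &D^1_\alpha=\tau\xi_1+\alpha t^{-1}\xi_1\xi_2\eta_2,\quad D^2_\alpha=\tau\xi_2-\alpha t^{-1}\xi_1\xi_2\eta_1,\\ &D^3_\alpha=\tau\eta_1+\alpha t^{-1}\xi_2\eta_1\eta_2,\quad D^4_\alpha=\tau\eta_2-\alpha t^{-1}\xi_1\eta_1\eta_2. \end{aligned}$$ Let $\Gamma_\alpha=\rho_\alpha(\Gamma(2,-1-\alpha,\alpha-1))$ be its image, the span of these $17$ elements; maps on $\Gamma_\alpha$ are regarded as maps on $\Gamma(2,-1-\alpha,\alpha-1)$ by means of $\rho_\alpha$. The algebra $\Gamma_\alpha$ acts on $K'(4)$ by the bracket; $H^1$ denotes the first cohomology of a Lie superalgebra (even and odd cochains). **Corollary.** Let $\alpha\in\mathbb C$. The map $\rho_\alpha$ is an embedding of Lie superalgebras with values in $K'(4)$, and $$\dim H^1(\Gamma_\alpha,K'(4))=1.$$ This space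 is spanned by the class of the even $1$-cocycle $\theta:\Gamma_\alpha\to K'(4)$ given by $$\begin{aligned} &\theta(T^1_\alpha)=\tau^{-1}\xi_2\eta_1\eta_2,\quad \theta(T^2_\alpha)=-\tau^{-1}\xi_1\eta_1\eta_2,\quad \theta(T^3_\alpha)=\tau^{-1}\xi_1\xi_2\eta_2,\quad \theta(T^4_\alpha)=-\tau^{-1}\xi_1\xi_2\eta_1,\\ &\theta(D^1_\alpha)=t^{-1}\xi_1\xi_2\eta_2,\quad \theta(D^2_\alpha)=-t^{-1}\xi_1\xi_2\eta_1,\quad \theta(D^3_\alpha)=t^{-1}\xi_2\eta_1\eta_2,\quad \theta(D^4_\alpha)=-t^{-1}\xi_1\eta_1\eta_2,\\ &\theta(E^1_\alpha)=2\tau^{-2}\xi_1\xi_2\eta_1\eta_2,\quad \theta(F^1_\alpha)=-2t^{-2}\xi_1\xi_2\eta_1\eta_2, \end{aligned}$$ and $\theta=0$ on $H^1_\alpha$ and on $E^i_\alpha,F^i_\alpha,H^i_\alpha$ for $i=2,3$. Moreover $\theta(X)=\{X,c_3\}$ for $X\in\Gamma_\alpha$, where $c_3=t^{-1}\tau^{-1}\xi_1\xi_2\eta_1\eta_2$.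 The cup product $[[\theta,\theta]](X,Y)=2\{\theta(X),\theta(Y)\}$ vanishes identically, and $\rho_\alpha+\beta\theta$ is a formal deformation of the embedding $\rho_\alpha$ into $K'(4)$: it is an even map that respects brackets identically in the formal parameter $\beta$, and hence is a homomorphism of Lie superalgebras for every $\beta\in\mathbb C$. -/

import Mathlib

open LaurentPolynomial

noncomputable section

namespace D21

/-! ### Brackets on `ℤ/2`-graded spaces, first cohomology, deformations of homomorphisms -/

/-- A complex vector space with an even and an odd part (`part 0` and `part 1`) and a bilinear
bracket: the data of a Lie superalgebra. Below it is only used for the two explicit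
Lie superalgebras `gamma σ₁ σ₂ σ₃` and `poisson`. -/
structure SuperBracket (V : Type*) [AddCommGroup V] [Module ℂ V] where
  part : ZMod 2 → Submodule ℂ V
  br : V →ₗ[ℂ] V →ₗ[ℂ] V

/-- The sign `(-1)^(p q)` for parities `p`, `q`. -/
def ksign (p q : ZMod 2) : ℂ := (-1) ^ (p.val * q.val)

section General

variable {g h : Type*} [AddCommGroup g] [Module ℂ g] [AddCommGroup h] [Module ℂ h]

/-- `c` is a linear map of parity `p`. -/
def HasParity (L : SuperBracket g) (M : SuperBracket h) (p : ZMod 2) (c : g →ₗ[ℂ] h) : Prop :=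
  ∀ q : ZMod 2, ∀ X ∈ L.part q, c X ∈ M.part (p + q)

/-- Homomorphisms of Lie superalgebras: even linear maps compatible with the brackets. -/
def IsSuperHom (L : SuperBracket g) (M : SuperBracket h) (ρ : g →ₗ[ℂ] h) : Prop :=
  HasParity L M 0 ρ ∧ ∀ X Y, ρ (L.br X Y) = M.br (ρ X) (ρ Y)

/-- The 1-cocycles of parity `p` of `g` with values in `N`. Here `N` is a subsuperalgebra of `h`
containing the image of `ρ`, and `g` acts on it by `X • n = [ρ X, n]`. The condition is `dc = 0`,
where, for homogeneous `X`, `Y`, the element `dc (X, Y)` is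
`(-1)^(p(c)p(X)) [ρ X, c Y] - (-1)^(p(Y)(p(c)+p(X))) [ρ Y, c X] - c [X, Y]`. -/
def cocyclesOfParity (L : SuperBracket g) (M : SuperBracket h) (ρ : g →ₗ[ℂ] h)
    (N : Submodule ℂ h) (p : ZMod 2) : Submodule ℂ (g →ₗ[ℂ] h) where
  carrier := {c | (∀ X, c X ∈ N) ∧ HasParity L M p c ∧
    ∀ q r : ZMod 2, ∀ X ∈ L.part q, ∀ Y ∈ L.part r,
      ksign p q • M.br (ρ X) (c Y) - ksign r (p + q) • M.br (ρ Y) (c X) - c (L.br X Y) = 0}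
  zero_mem' := by
    refine ⟨fun X => by simp, fun q X _ => by simp, fun q r X _ Y _ => by simp⟩
  add_mem' := by
    rintro c d ⟨hc1, hc2, hc3⟩ ⟨hd1, hd2, hd3⟩
    refine ⟨fun X => N.add_mem (hc1 X) (hd1 X),
      fun q X hX => (M.part _).add_mem (hc2 q X hX) (hd2 q X hX), fun q r X hX Y hY => ?_⟩
    have h1 := hc3 q r X hX Y hY
    have h2 := hd3 q r X hX Y hY
    calc _ = (ksign p q • M.br (ρ X) (c Y) - ksign r (p + q) • M.br (ρ Y) (c X) - c (L.br X Y))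
          + (ksign p q • M.br (ρ X) (d Y) - ksign r (p + q) • M.br (ρ Y) (d X)
              - d (L.br X Y)) := by
            simp only [LinearMap.add_apply, map_add, smul_add]; abel
      _ = 0 := by rw [h1, h2, add_zero]
  smul_mem' := by
    rintro a c ⟨hc1, hc2, hc3⟩
    refine ⟨fun X => N.smul_mem a (hc1 X), fun q X hX => (M.part _).smul_mem a (hc2 q X hX),
      fun q r X hX Y hY => ?_⟩
    have h1 := hc3 q r X hX Y hY
    calc _ = a • (ksign p q • M.br (ρ X) (c Y) - ksign r (p + q) • M.br (ρ Y) (c X)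
              - c (L.br X Y)) := by
            simp only [LinearMap.smul_apply, map_smul, smul_sub, smul_comm a]
      _ = 0 := by rw [h1, smul_zero]

/-- The space `Z¹(g, N)` of 1-cocycles: sums of an even and an odd one. -/
def Z1 (L : SuperBracket g) (M : SuperBracket h) (ρ : g →ₗ[ℂ] h) (N : Submodule ℂ h) :
    Submodule ℂ (g →ₗ[ℂ] h) :=
  cocyclesOfParity L M ρ N 0 ⊔ cocyclesOfParity L M ρ N 1

/-- The space `B¹(g, N)` of 1-coboundaries, spanned by the maps `dn`,
`dn (X) = (-1)^(p(n)p(X)) [ρ X, n]`, for homogeneous `n ∈ N`. -/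
def B1 (L : SuperBracket g) (M : SuperBracket h) (ρ : g →ₗ[ℂ] h) (N : Submodule ℂ h) :
    Submodule ℂ (g →ₗ[ℂ] h) :=
  Submodule.span ℂ {c | ∃ p : ZMod 2, ∃ n ∈ N, n ∈ M.part p ∧
    ∀ q : ZMod 2, ∀ X ∈ L.part q, c X = ksign p q • M.br (ρ X) n}

/-- The first cohomology space `H¹(g, N) = Z¹(g, N) / B¹(g, N)`. -/
abbrev H1 (L : SuperBracket g) (M : SuperBracket h) (ρ : g →ₗ[ℂ] h) (N : Submodule ℂ h) :=
  Z1 L M ρ N ⧸ (B1 L M ρ N).submoduleOf (Z1 L M ρ N)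

/-- The cup product `[[φ, φ']] (X, Y) = [φ X, φ' Y] + [φ' X, φ Y]`. -/
def cup (M : SuperBracket h) (φ φ' : g →ₗ[ℂ] h) (X Y : g) : h :=
  M.br (φ X) (φ' Y) + M.br (φ' X) (φ Y)

/-- The formal series `∑ₖ βᵏ rₖ` is a formal deformation of `ρ : g → N`: one has `r₀ = ρ`, every
`rₖ` is an even linear map `g → N`, and the series respects brackets, coefficient by coefficient
in `β`. -/
def IsFormalDeformation (L : SuperBracket g) (M : SuperBracket h) (N : Submodule ℂ h)
    (ρ : g →ₗ[ℂ] h) (r : ℕ → g →ₗ[ℂ] h) : Prop :=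
  r 0 = ρ ∧ (∀ k, HasParity L M 0 (r k)) ∧ (∀ k X, r k X ∈ N) ∧
    ∀ n X Y, r n (L.br X Y) = ∑ ij ∈ Finset.HasAntidiagonal.antidiagonal n, M.br (r ij.1 X) (r ij.2 Y)

end General

/-! ### The Lie superalgebra `Γ(σ₁, σ₂, σ₃)` -/

/-- The matrix of the form `ψ` on `ℂ²` with `ψ(e₁, e₂) = -ψ(e₂, e₁) = 1`. -/
def psiMat : Matrix (Fin 2) (Fin 2) ℂ := !![0, 1; -1, 0]

/-- The form `ψ`. -/
def psi (x y : Fin 2 → ℂ) : ℂ := x ⬝ᵥ psiMat.mulVec y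

/-- The Lie algebra `sp(ψ)`. -/
abbrev Sp := skewAdjointMatricesLieSubalgebra psiMat

lemma psi_eq (x y : Fin 2 → ℂ) : psi x y = x 0 * y 1 - x 1 * y 0 := by
  simp [psi, psiMat, dotProduct, Matrix.mulVec, Fin.sum_univ_two]
  ring

/-- The matrix of the endomorphism `z ↦ ψ(y, z) x - ψ(z, x) y`, see `spMap_mulVec`. -/
def spMap (x y : Fin 2 → ℂ) : Sp :=
  ⟨Matrix.of fun i k => psi y (Pi.single k 1) * x i - psi (Pi.single k 1) x * y i, by
    rw [mem_skewAdjointMatricesLieSubalgebra, mem_skewAdjointMatricesSubmodule]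
    ext i j
    fin_cases i <;> fin_cases j <;>
      simp [psi_eq, psiMat, Matrix.mul_apply, Fin.sum_univ_two] <;> ring⟩

lemma spMap_mulVec (x y z : Fin 2 → ℂ) :
    (spMap x y : Matrix (Fin 2) (Fin 2) ℂ).mulVec z = psi y z • x - psi z x • y := by
  ext i
  fin_cases i <;> simp [spMap, psi_eq, Matrix.mulVec, dotProduct, Fin.sum_univ_two] <;> ring

/-- The even part `sp(ψ₁) ⊕ sp(ψ₂) ⊕ sp(ψ₃)`. -/
abbrev GammaEven := Sp × Sp × Sp

/-- The odd part `V₁ ⊗ V₂ ⊗ V₃`, in coordinates: `u i j k` is the coefficient of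
`eᵢ ⊗ fⱼ ⊗ hₖ`. -/
abbrev GammaOdd := Fin 2 → Fin 2 → Fin 2 → ℂ

/-- The underlying space of `Γ(σ₁, σ₂, σ₃)`. -/
abbrev GammaSpace := GammaEven × GammaOdd

/-- The action of the even part on the odd part: the tensor product of the standard
representations. -/
def act (m : GammaEven) (u : GammaOdd) : GammaOdd := fun i j k =>
  ∑ l, (m.1.1 i l * u l j k + m.2.1.1 j l * u i l k + m.2.2.1 k l * u i j l)

/-- The standard basis vectors of `ℂ²`. -/
def stdVec (i : Fin 2) : Fin 2 → ℂ := Pi.single i 1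

/-- The bracket of two decomposable odd basis vectors `e_{i₁} ⊗ f_{i₂} ⊗ h_{i₃}` and
`e_{j₁} ⊗ f_{j₂} ⊗ h_{j₃}`. -/
def oddBasisBracket (σ₁ σ₂ σ₃ : ℂ) (i₁ i₂ i₃ j₁ j₂ j₃ : Fin 2) : GammaEven :=
  let ψ := fun i j => psi (stdVec i) (stdVec j)
  let π := fun i j => spMap (stdVec i) (stdVec j)
  ((σ₁ * ψ i₂ j₂ * ψ i₃ j₃) • π i₁ j₁,
   (σ₂ * ψ i₁ j₁ * ψ i₃ j₃) • π i₂ j₂,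
   (σ₃ * ψ i₁ j₁ * ψ i₂ j₂) • π i₃ j₃)

/-- The bracket of odd elements, the bilinear extension of `oddBasisBracket`. -/
def oddBracket (σ₁ σ₂ σ₃ : ℂ) (u v : GammaOdd) : GammaEven :=
  ∑ i₁, ∑ i₂, ∑ i₃, ∑ j₁, ∑ j₂, ∑ j₃,
    (u i₁ i₂ i₃ * v j₁ j₂ j₃) • oddBasisBracket σ₁ σ₂ σ₃ i₁ i₂ i₃ j₁ j₂ j₃

/-- `Γ(σ₁, σ₂, σ₃)`. -/
def gamma (σ₁ σ₂ σ₃ : ℂ) : SuperBracket GammaSpace where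
  part p := if p = 0 then LinearMap.ker (LinearMap.snd ℂ GammaEven GammaOdd)
    else LinearMap.ker (LinearMap.fst ℂ GammaEven GammaOdd)
  br := LinearMap.mk₂ ℂ
    (fun X Y => (⁅X.1, Y.1⁆ + oddBracket σ₁ σ₂ σ₃ X.2 Y.2, act X.1 Y.2 - act Y.1 X.2))
    (by
      intro X X' Y
      refine Prod.ext ?_ ?_
      · simp only [oddBracket, Prod.fst_add, Prod.snd_add, add_lie, Pi.add_apply, add_mul,
          add_smul, Finset.sum_add_distrib]
        abel
      · ext i j k
        simp [act, Fin.sum_univ_two]; ring)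
    (by
      intro a X Y
      refine Prod.ext ?_ ?_
      · simp only [oddBracket, Prod.smul_fst, Prod.smul_snd, smul_lie, Pi.smul_apply, smul_eq_mul,
          mul_assoc, mul_smul, smul_add, Finset.smul_sum]
      · ext i j k
        simp [act, Fin.sum_univ_two]; ring)
    (by
      intro X Y Y'
      refine Prod.ext ?_ ?_
      · simp only [oddBracket, Prod.fst_add, Prod.snd_add, lie_add, Pi.add_apply, mul_add,
          add_smul, Finset.sum_add_distrib]
        abel
      · ext i j k
        simp [act, Fin.sum_univ_two]; ring)
    (by
      intro a X Y
      refine Prod.ext ?_ ?_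
      · simp only [oddBracket, Prod.smul_fst, Prod.smul_snd, lie_smul, Pi.smul_apply, smul_eq_mul,
          mul_left_comm _ a, mul_smul, smul_add, Finset.smul_sum]
      · ext i j k
        simp [act, Fin.sum_univ_two]; ring)

/-! ### The Poisson superalgebra `P(4)` -/

/-- The algebra `P` of formal series `∑_{i ≤ n} aᵢ(t) τⁱ` with `aᵢ ∈ ℂ[t, t⁻¹]`, that is,
Laurent series in `τ⁻¹`: the coefficient of `τⁱ` is `HahnSeries.coeff f (-i)`. -/
def P : Type := LaurentSeries ℂ[T;T⁻¹]

instance : CommRing P := inferInstanceAs (CommRing (LaurentSeries ℂ[T;T⁻¹]))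

instance : Algebra ℂ P :=
  (HahnSeries.instAlgebra : Algebra ℂ (HahnSeries ℤ ℂ[T;T⁻¹]))

/-- The coefficient of `τⁱ`. -/
def P.tauCoeff (f : P) (i : ℤ) : ℂ[T;T⁻¹] := HahnSeries.coeff f (-i)

/-- The element `∑ᵢ aᵢ τⁱ` of `P`, for a family of coefficients that vanish for large `i`. -/
def P.ofTauCoeff (a : ℤ → ℂ[T;T⁻¹]) (ha : ∃ n, ∀ i, n < i → a i = 0) : P :=
  HahnSeries.ofSuppBddBelow (fun k => a (-k)) <| by
    obtain ⟨n, hn⟩ := ha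
    refine ⟨-n, fun k hk => ?_⟩
    by_contra h
    exact hk (hn (-k) (by omega))

lemma P.tauCoeff_ofTauCoeff (a : ℤ → ℂ[T;T⁻¹]) (ha : ∃ n, ∀ i, n < i → a i = 0) (i : ℤ) :
    (P.ofTauCoeff a ha).tauCoeff i = a i := by
  change a (- -i) = a i
  rw [neg_neg]

lemma P.tauCoeff_bdd (f : P) : ∃ n, ∀ i, n < i → f.tauCoeff i = 0 :=
  ⟨-(HahnSeries.order (Γ := ℤ) (R := ℂ[T;T⁻¹]) f), fun i hi =>
    HahnSeries.coeff_eq_zero_of_lt_order (Γ := ℤ) (R := ℂ[T;T⁻¹]) (x := f) (by omega)⟩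

lemma P.ext_tauCoeff {f g : P} (h : ∀ i, f.tauCoeff i = g.tauCoeff i) : f = g := by
  refine HahnSeries.ext (Γ := ℤ) (R := ℂ[T;T⁻¹]) (funext fun k => ?_)
  have := h (-k)
  simpa [P.tauCoeff] using this

lemma P.tauCoeff_add (f g : P) (i : ℤ) : (f + g).tauCoeff i = f.tauCoeff i + g.tauCoeff i := rfl

lemma P.tauCoeff_smul (a : ℂ) (f : P) (i : ℤ) : (a • f).tauCoeff i = a • f.tauCoeff i := rfl

/-- The derivative `d/dt` on `ℂ[t, t⁻¹]`. -/
def lderiv : ℂ[T;T⁻¹] →ₗ[ℂ] ℂ[T;T⁻¹] where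
  toFun f := f.coeff.sum fun n a => (n * a : ℂ) • T (n - 1)
  map_add' f g := by
    rw [AddMonoidAlgebra.coeff_add, Finsupp.sum_add_index'] <;> intros <;> simp [mul_add, add_smul]
  map_smul' c f := by
    rw [AddMonoidAlgebra.coeff_smul, Finsupp.sum_smul_index', RingHom.id_apply, Finsupp.smul_sum]
    · simp only [smul_eq_mul, smul_smul, mul_left_comm]
    · simp

/-- `∂ₜ` on `P`. -/
def dtP : P →ₗ[ℂ] P where
  toFun f := P.ofTauCoeff (fun i => lderiv (f.tauCoeff i)) <| by
    obtain ⟨n, hn⟩ := f.tauCoeff_bdd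
    exact ⟨n, fun i hi => by rw [hn i hi, map_zero]⟩
  map_add' f g := P.ext_tauCoeff fun i => by
    simp only [P.tauCoeff_add, P.tauCoeff_ofTauCoeff, map_add]
  map_smul' a f := P.ext_tauCoeff fun i => by
    simp only [P.tauCoeff_smul, P.tauCoeff_ofTauCoeff, map_smul, RingHom.id_apply]

/-- `∂_τ` on `P`: the coefficient of `τⁱ` in `∂_τ (∑ aᵢ τⁱ)` is `(i + 1) aᵢ₊₁`. -/
def dtauP : P →ₗ[ℂ] P where
  toFun f := P.ofTauCoeff (fun i => ((i : ℂ) + 1) • f.tauCoeff (i + 1)) <| by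
    obtain ⟨n, hn⟩ := f.tauCoeff_bdd
    exact ⟨n, fun i hi => by rw [hn (i + 1) (by omega), smul_zero]⟩
  map_add' f g := P.ext_tauCoeff fun i => by
    simp only [P.tauCoeff_add, P.tauCoeff_ofTauCoeff, smul_add]
  map_smul' a f := P.ext_tauCoeff fun i => by
    simp only [P.tauCoeff_smul, P.tauCoeff_ofTauCoeff, RingHom.id_apply, smul_comm a]

/-- The element `tᵃ τᵇ` of `P`. -/
def monoP (a b : ℤ) : P := (HahnSeries.single (-b) (T a) : LaurentSeries ℂ[T;T⁻¹])

/-- `P(4) = P ⊗ Λ(4)`. The odd variables are numbered `ξ₁ = 0`, `ξ₂ = 1`, `η₁ = 2`, `η₂ = 3`, and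
`A I` is the coefficient in `A` of the product of the odd variables in `I`, taken in increasing
order. The product is `gmul`, not the pointwise one. -/
def P4 : Type := Finset (Fin 4) → P

instance : AddCommGroup P4 := inferInstanceAs (AddCommGroup (Finset (Fin 4) → P))

instance : Module ℂ P4 := inferInstanceAs (Module ℂ (Finset (Fin 4) → P))

lemma P4.add_apply (A B : P4) (I : Finset (Fin 4)) : (A + B) I = A I + B I := rfl

lemma P4.smul_apply (a : ℂ) (A : P4) (I : Finset (Fin 4)) : (a • A) I = a • A I := rfl

/-- The coefficient map `A ↦ A I`. -/
def P4.coeff (I : Finset (Fin 4)) : P4 →ₗ[ℂ] P where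
  toFun A := A I
  map_add' _ _ := rfl
  map_smul' _ _ := rfl

/-- The linear map into `P(4)` with the given coefficients. -/
def P4.ofCoeffs {V : Type*} [AddCommGroup V] [Module ℂ V] (F : Finset (Fin 4) → V →ₗ[ℂ] P) :
    V →ₗ[ℂ] P4 where
  toFun x := fun I => F I x
  map_add' x y := funext fun I => map_add (F I) x y
  map_smul' a x := funext fun I => map_smul (F I) a x

lemma P4.coeff_apply (I : Finset (Fin 4)) (A : P4) : P4.coeff I A = A I := rfl

lemma P4.ofCoeffs_apply {V : Type*} [AddCommGroup V] [Module ℂ V]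
    (F : Finset (Fin 4) → V →ₗ[ℂ] P) (x : V) (I : Finset (Fin 4)) :
    P4.ofCoeffs F x I = F I x := rfl

/-- The sign relating the product of the ordered monomials on the disjoint sets `I` and `J` to the
ordered monomial on `I ∪ J`. -/
def shuffleSign (I J : Finset (Fin 4)) : ℂ :=
  (-1) ^ ((I ×ˢ J).filter fun ij => ij.2 < ij.1).card

/-- The product of the associative superalgebra `P(4)`. -/
def gmulFun (A B : P4) : P4 :=
  fun K => ∑ I ∈ K.powerset, shuffleSign I (K \ I) • (A I * B (K \ I))

lemma gmulFun_apply (A B : P4) (K : Finset (Fin 4)) :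
    gmulFun A B K = ∑ I ∈ K.powerset, shuffleSign I (K \ I) • (A I * B (K \ I)) := rfl

/-- The product of `P(4)`, as a bilinear map. -/
def gmul : P4 →ₗ[ℂ] P4 →ₗ[ℂ] P4 :=
  LinearMap.mk₂ ℂ gmulFun
    (fun A A' B => funext fun K => by
      simp only [P4.add_apply, gmulFun_apply, add_mul, smul_add, Finset.sum_add_distrib])
    (fun a A B => funext fun K => by
      simp only [P4.smul_apply, gmulFun_apply, smul_mul_assoc, Finset.smul_sum, smul_comm a])
    (fun A B B' => funext fun K => by
      simp only [P4.add_apply, gmulFun_apply, mul_add, smul_add, Finset.sum_add_distrib])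
    (fun a A B => funext fun K => by
      simp only [P4.smul_apply, gmulFun_apply, mul_smul_comm, Finset.smul_sum, smul_comm a])

/-- `∂ₜ` on `P(4)`. -/
def dt : P4 →ₗ[ℂ] P4 := P4.ofCoeffs fun I => dtP ∘ₗ P4.coeff I

/-- `∂_τ` on `P(4)`. -/
def dtau : P4 →ₗ[ℂ] P4 := P4.ofCoeffs fun I => dtauP ∘ₗ P4.coeff I

/-- The left partial derivative with respect to the odd variable `i`. -/
def dodd (i : Fin 4) : P4 →ₗ[ℂ] P4 := P4.ofCoeffs fun K =>
  if i ∈ K then 0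
  else ((-1 : ℂ) ^ (K.filter fun k => k < i).card) • P4.coeff (insert i K)

/-- The parity involution `A ↦ (-1)^p(A) A`. -/
def parityInv : P4 →ₗ[ℂ] P4 := P4.ofCoeffs fun K => ((-1 : ℂ) ^ K.card) • P4.coeff K

/-- The index of the variable `ξ_{i+1}`. -/
def xiIdx (i : Fin 2) : Fin 4 := ![0, 1] i

/-- The index of the variable `η_{i+1}`. -/
def etaIdx (i : Fin 2) : Fin 4 := ![2, 3] i

/-- The Poisson superalgebra `P(4)`, with
`{A, B} = ∂_τ A ∂ₜ B - ∂ₜ A ∂_τ B + (-1)^(p(A)+1) ∑ᵢ (∂_{ξᵢ} A ∂_{ηᵢ} B + ∂_{ηᵢ} A ∂_{ξᵢ} B)`. -/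
def poisson : SuperBracket P4 where
  part p := ⨅ I : {I : Finset (Fin 4) // (I.card : ZMod 2) ≠ p}, LinearMap.ker (P4.coeff I)
  br := gmul.compl₁₂ dtau dt - gmul.compl₁₂ dt dtau -
    ∑ i : Fin 2, (gmul.compl₁₂ (dodd (xiIdx i) ∘ₗ parityInv) (dodd (etaIdx i)) +
      gmul.compl₁₂ (dodd (etaIdx i) ∘ₗ parityInv) (dodd (xiIdx i)))

/-- The monomial `tᵃ τᵇ` times the ordered product of the odd variables in `I`. -/
def mono (a b : ℤ) (I : Finset (Fin 4)) : P4 := fun J => if J = I then monoP a b else 0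

/-- The homogeneous component `P_{(d)}(4)` of `P(4)` for the grading in which
`t, τ, ξ₁, ξ₂, η₁, η₂` all have degree one. -/
def degreePart (d : ℤ) : Submodule ℂ P4 :=
  Submodule.span ℂ {A | ∃ (a b : ℤ) (I : Finset (Fin 4)), a + b + I.card = d ∧ A = mono a b I}

/-- The contact superconformal algebra `K(4)`, the degree two part of `P(4)`. -/
def K4 : Submodule ℂ P4 := degreePart 2

/-- The derived Lie superalgebra `K'(4) = [K(4), K(4)]`. -/
def K4' : Submodule ℂ P4 :=
  Submodule.span ℂ {C | ∃ A ∈ K4, ∃ B ∈ K4, C = poisson.br A B}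

/-! ### The embedding `ρ_α` and the cocycle `θ` -/

/-- Labels of the basis of `Γ_α`. -/
inductive Gen
  | E1 | F1 | H1 | E2 | F2 | H2 | E3 | F3 | H3 | T1 | T2 | T3 | T4 | D1 | D2 | D3 | D4

/-- The basis `E_α¹, …, D_α⁴` of `Γ_α ⊆ P(4)`. -/
def gen (α : ℂ) : Gen → P4
  | .E1 => mono 2 0 ∅
  | .F1 => mono 0 2 ∅ - (2 * α) • mono (-2) 0 {0, 1, 2, 3}
  | .H1 => mono 1 1 ∅
  | .E2 => mono 0 0 {0, 1}
  | .F2 => mono 0 0 {2, 3}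
  | .H2 => mono 0 0 {0, 2} + mono 0 0 {1, 3}
  | .E3 => mono 0 0 {0, 3}
  | .F3 => mono 0 0 {1, 2}
  | .H3 => mono 0 0 {0, 2} - mono 0 0 {1, 3}
  | .T1 => mono 1 0 {2}
  | .T2 => mono 1 0 {3}
  | .T3 => mono 1 0 {0}
  | .T4 => mono 1 0 {1}
  | .D1 => mono 0 1 {0} + α • mono (-1) 0 {0, 1, 3}
  | .D2 => mono 0 1 {1} - α • mono (-1) 0 {0, 1, 2}
  | .D3 => mono 0 1 {2} + α • mono (-1) 0 {1, 2, 3}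
  | .D4 => mono 0 1 {3} - α • mono (-1) 0 {0, 2, 3}

/-- The values of `θ` on the basis of `Γ_α`. -/
def thetaVal : Gen → P4
  | .T1 => mono 0 (-1) {1, 2, 3}
  | .T2 => -mono 0 (-1) {0, 2, 3}
  | .T3 => mono 0 (-1) {0, 1, 3}
  | .T4 => -mono 0 (-1) {0, 1, 2}
  | .D1 => mono (-1) 0 {0, 1, 3}
  | .D2 => -mono (-1) 0 {0, 1, 2}
  | .D3 => mono (-1) 0 {1, 2, 3}
  | .D4 => -mono (-1) 0 {0, 2, 3}
  | .E1 => (2 : ℂ) • mono 0 (-2) {0, 1, 2, 3}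
  | .F1 => -(2 : ℂ) • mono (-2) 0 {0, 1, 2, 3}
  | _ => 0

/-- The linear map from the space of `Γ(σ₁, σ₂, σ₃)` to `W` that takes the value `v b` on the element of
`Γ(σ₁, σ₂, σ₃)` which corresponds to the basis element of `Γ_α` labelled by `b`. Its values on
the elements `𝒫₁(e₁, e₁)`, …, `e₂ ⊗ f₂ ⊗ h₂` are listed in `fromGen_even₁`, …, `fromGen_odd`. -/
def fromGen {W : Type*} [AddCommGroup W] [Module ℂ W] (v : Gen → W) : GammaSpace →ₗ[ℂ] W where
  toFun X :=
    let m₁ := X.1.1.1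
    let m₂ := X.1.2.1.1
    let m₃ := X.1.2.2.1
    let u := X.2
    (-(m₁ 0 1 / 2) • v .E1 + (m₁ 1 0 / 2) • v .F1 + m₁ 0 0 • v .H1) +
    (m₂ 1 0 • v .E2 - m₂ 0 1 • v .F2 - m₂ 0 0 • v .H2) +
    (-(m₃ 1 0) • v .E3 - m₃ 0 1 • v .F3 - m₃ 0 0 • v .H3) +
    ((Real.sqrt 2 : ℂ) * Complex.I) •
      (u 0 0 0 • v .T1 + u 0 0 1 • v .T2 - u 0 1 0 • v .T4 + u 0 1 1 • v .T3 +
        u 1 0 0 • v .D3 + u 1 0 1 • v .D4 - u 1 1 0 • v .D2 + u 1 1 1 • v .D1)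
  map_add' X Y := by
    simp
    module
  map_smul' a X := by
    simp
    module

/-- The decomposable vector `e_{i+1} ⊗ f_{j+1} ⊗ h_{k+1}`. -/
def oddVec (i j k : Fin 2) : GammaSpace :=
  (0, fun i' j' k' => stdVec i i' * stdVec j j' * stdVec k k')

lemma fromGen_even₁ {W : Type*} [AddCommGroup W] [Module ℂ W] (v : Gen → W) :
    fromGen v ((spMap (stdVec 0) (stdVec 0), 0, 0), 0) = -v .E1 ∧
    fromGen v ((spMap (stdVec 1) (stdVec 1), 0, 0), 0) = -v .F1 ∧
    fromGen v ((spMap (stdVec 0) (stdVec 1), 0, 0), 0) = -v .H1 := by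
  refine ⟨?_, ?_, ?_⟩ <;> simp [fromGen, spMap, psi_eq, stdVec]; module

lemma fromGen_even₂ {W : Type*} [AddCommGroup W] [Module ℂ W] (v : Gen → W) :
    fromGen v ((0, spMap (stdVec 0) (stdVec 0), 0), 0) = -(2 : ℂ) • v .F2 ∧
    fromGen v ((0, spMap (stdVec 1) (stdVec 1), 0), 0) = -(2 : ℂ) • v .E2 ∧
    fromGen v ((0, spMap (stdVec 0) (stdVec 1), 0), 0) = v .H2 := by
  refine ⟨?_, ?_, ?_⟩ <;> simp [fromGen, spMap, psi_eq, stdVec] <;> module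

lemma fromGen_even₃ {W : Type*} [AddCommGroup W] [Module ℂ W] (v : Gen → W) :
    fromGen v ((0, 0, spMap (stdVec 0) (stdVec 0)), 0) = -(2 : ℂ) • v .F3 ∧
    fromGen v ((0, 0, spMap (stdVec 1) (stdVec 1)), 0) = (2 : ℂ) • v .E3 ∧
    fromGen v ((0, 0, spMap (stdVec 0) (stdVec 1)), 0) = v .H3 := by
  refine ⟨?_, ?_, ?_⟩ <;> simp [fromGen, spMap, psi_eq, stdVec] <;> module

lemma fromGen_odd {W : Type*} [AddCommGroup W] [Module ℂ W] (v : Gen → W) :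
    let s : ℂ := (Real.sqrt 2 : ℂ) * Complex.I
    fromGen v (oddVec 0 0 0) = s • v .T1 ∧ fromGen v (oddVec 0 0 1) = s • v .T2 ∧
    fromGen v (oddVec 0 1 0) = -s • v .T4 ∧ fromGen v (oddVec 0 1 1) = s • v .T3 ∧
    fromGen v (oddVec 1 0 0) = s • v .D3 ∧ fromGen v (oddVec 1 0 1) = s • v .D4 ∧
    fromGen v (oddVec 1 1 0) = -s • v .D2 ∧ fromGen v (oddVec 1 1 1) = s • v .D1 := by
  refine ⟨?_, ?_, ?_, ?_, ?_, ?_, ?_, ?_⟩ <;> simp [fromGen, oddVec, stdVec]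

/-- `Γ(2, -1 - α, α - 1)`. -/
def gammaAlpha (α : ℂ) : SuperBracket GammaSpace := gamma 2 (-1 - α) (α - 1)

/-- The embedding `ρ_α` of `Γ(2, -1 - α, α - 1)`. -/
def rho (α : ℂ) : GammaSpace →ₗ[ℂ] P4 := fromGen (gen α)

/-- The map `θ`, on `Γ(2, -1 - α, α - 1)` identified with its image `Γ_α` under `ρ_α`. -/
def theta : GammaSpace →ₗ[ℂ] P4 := fromGen thetaVal

/-- `c₃ = t⁻¹ τ⁻¹ ξ₁ ξ₂ η₁ η₂`. -/
def c3 : P4 := mono (-1) (-1) {0, 1, 2, 3}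

end D21

end

namespace D21

/-! ### Monomials of `P(4)` -/

/-! `K4` is a linear span of monomials, so `K4'` contains no infinite series, and the problem can be
moved to `Free`, the finitely supported functions on exponents. There the bracket of two monomials
is an explicit list of terms with integer coefficients, and identities among the 17 basis elements
become finite integer computations. The basis elements and the structure constants are both affine
in `α`, so comparing powers of `α` turns each identity for all `α` into a few integer ones. This
gives the homomorphism property of `ρ_α` (`brFree_elt`), the derivation property of `θ`
(`brFree_elt_thetaElt`), the vanishing of `[θ, θ]` (`brFree_thetaElt`) and `θ = [·, c₃]`
(`thetaElt_eq`).

The algebra `K'(4)` is spanned by all monomials of degree two except `c₃` (`K4'_eq`): the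
coefficient of `c₃` is a residue that vanishes on brackets. So `θ` is the restriction of an inner
derivation by an element just outside `K'(4)`. It is not a coboundary: the coefficient of
`τ⁻²ξ₁ξ₂η₁η₂` in `[t², n]` is twice the coefficient of `c₃` in `n`, hence zero for `n` in `K'(4)`,
while it equals 2 for `θ` (`theta_notMem_B1`).

The upper bound rests on the torus spanned by `tτ`, `ξ₁η₁`, `ξ₂η₂`, which lies in `Γ_α`. The
combination `30 tτ + 5 ξ₁η₁ + ξ₂η₂` acts diagonally with integer weights. Odd variables contribute
between -6 and 6 in total, so the weight records the exponent difference of `t` and `τ` and the odd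
weight separately. The cocycle condition against this element shows that the part of a cocycle that
shifts weights is a coboundary (`IsFreeCocycle.exists_eq_add_weightProj`). Weights modulo 2 are
parities, so an odd cocycle has no further part. For an even cocycle the weight-preserving part has
finitely many coefficients. They satisfy a linear system whose solutions are determined by four of
them, and the three torus coboundaries together with `θ` realise all values of these four
(`IsFreeCocycle.exists_weightProj_eq`). -/

lemma tauCoeff_monoP (a b i : ℤ) : (monoP a b).tauCoeff i = if i = b then T a else 0 := by
  have : (monoP a b).tauCoeff i = (HahnSeries.single (-b) (T a : ℂ[T;T⁻¹])).coeff (-i) := rfl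
  rw [this, HahnSeries.coeff_single]
  simp

lemma monoP_mul (a b c d : ℤ) : monoP a b * monoP c d = monoP (a + c) (b + d) := by
  have h := HahnSeries.single_mul_single (Γ := ℤ) (a := -b) (b := -d)
    (r := (T a : ℂ[T;T⁻¹])) (s := T c)
  rw [← T_add, ← neg_add] at h
  exact h

lemma lderiv_T (n : ℤ) : lderiv (T n) = (n : ℂ) • T (n - 1) := by
  change (Finsupp.sum (T n : ℂ[T;T⁻¹]).coeff fun n a => (n * a : ℂ) • (T (n - 1) : ℂ[T;T⁻¹])) = _
  have : (T n : ℂ[T;T⁻¹]).coeff = Finsupp.single n 1 := rfl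
  rw [this, Finsupp.sum_single_index] <;> simp

lemma dtP_monoP (a b : ℤ) : dtP (monoP a b) = (a : ℂ) • monoP (a - 1) b := by
  refine P.ext_tauCoeff fun i => ?_
  have h : (dtP (monoP a b)).tauCoeff i = lderiv ((monoP a b).tauCoeff i) := by
    change lderiv ((monoP a b).tauCoeff (- -i)) = _
    rw [neg_neg]
  rw [h, P.tauCoeff_smul, tauCoeff_monoP, tauCoeff_monoP]
  split_ifs <;> simp [lderiv_T]

lemma dtauP_monoP (a b : ℤ) : dtauP (monoP a b) = (b : ℂ) • monoP a (b - 1) := by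
  refine P.ext_tauCoeff fun i => ?_
  have h : (dtauP (monoP a b)).tauCoeff i = ((i : ℂ) + 1) • (monoP a b).tauCoeff (i + 1) := by
    change (((- -i : ℤ) : ℂ) + 1) • (monoP a b).tauCoeff (- -i + 1) = _
    rw [neg_neg]
  rw [h, P.tauCoeff_smul, tauCoeff_monoP, tauCoeff_monoP]
  by_cases hi : i + 1 = b
  · subst hi; simp
  · rw [if_neg hi, if_neg (by omega)]; simp

lemma mono_apply (a b : ℤ) (I J : Finset (Fin 4)) :
    mono a b I J = if J = I then monoP a b else 0 := rfl

lemma P4.ext {A B : P4} (h : ∀ I, A I = B I) : A = B := funext h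

lemma dt_mono (a b : ℤ) (I : Finset (Fin 4)) : dt (mono a b I) = (a : ℂ) • mono (a - 1) b I := by
  refine P4.ext fun J => ?_
  change dtP (mono a b I J) = (a : ℂ) • mono (a - 1) b I J
  rw [mono_apply, mono_apply]
  split_ifs <;> simp [dtP_monoP]

lemma dtau_mono (a b : ℤ) (I : Finset (Fin 4)) :
    dtau (mono a b I) = (b : ℂ) • mono a (b - 1) I := by
  refine P4.ext fun J => ?_
  change dtauP (mono a b I J) = (b : ℂ) • mono a (b - 1) I J
  rw [mono_apply, mono_apply]
  split_ifs <;> simp [dtauP_monoP]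

lemma parityInv_mono (a b : ℤ) (I : Finset (Fin 4)) :
    parityInv (mono a b I) = ((-1 : ℂ) ^ I.card) • mono a b I := by
  refine P4.ext fun J => ?_
  change ((-1 : ℂ) ^ J.card) • mono a b I J = ((-1 : ℂ) ^ I.card) • mono a b I J
  rw [mono_apply]
  split_ifs with h <;> simp [h]

/-- The sign of the left derivative of the ordered monomial on `I` by the odd variable `i`. -/
def derivSign (i : Fin 4) (I : Finset (Fin 4)) : ℤ := (-1) ^ (I.filter fun k => k < i).card

lemma dodd_mono_of_mem {i : Fin 4} {I : Finset (Fin 4)} (hi : i ∈ I) (a b : ℤ) :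
    dodd i (mono a b I) = (derivSign i I : ℂ) • mono a b (I.erase i) := by
  refine P4.ext fun K => ?_
  change (if i ∈ K then (0 : P4 →ₗ[ℂ] P) else
    ((-1 : ℂ) ^ (K.filter fun k => k < i).card) • P4.coeff (insert i K)) (mono a b I) =
      (derivSign i I : ℂ) • mono a b (I.erase i) K
  rw [mono_apply]
  by_cases hK : i ∈ K
  · rw [if_pos hK, if_neg (by rintro rfl; simp at hK)]; simp
  · rw [if_neg hK, LinearMap.smul_apply, P4.coeff_apply, mono_apply]
    by_cases h : insert i K = I
    · subst h
      rw [if_pos rfl, Finset.erase_insert hK, if_pos rfl, derivSign]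
      simp [Finset.filter_insert]
    · rw [if_neg h, if_neg (by rintro rfl; exact h (Finset.insert_erase hi))]; simp

lemma dodd_mono_of_notMem {i : Fin 4} {I : Finset (Fin 4)} (hi : i ∉ I) (a b : ℤ) :
    dodd i (mono a b I) = 0 := by
  refine P4.ext fun K => ?_
  change (if i ∈ K then (0 : P4 →ₗ[ℂ] P) else
    ((-1 : ℂ) ^ (K.filter fun k => k < i).card) • P4.coeff (insert i K)) (mono a b I) = 0
  by_cases hK : i ∈ K
  · rw [if_pos hK]; simp
  · rw [if_neg hK, LinearMap.smul_apply, P4.coeff_apply, mono_apply,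
      if_neg (by rintro rfl; simp at hi), smul_zero]

/-- `shuffleSign` as an integer, and zero if the sets meet: the coefficient of the ordered monomial
on `I ∪ J` in the product of those on `I` and `J`. -/
def prodSign (I J : Finset (Fin 4)) : ℤ :=
  if Disjoint I J then (-1) ^ ((I ×ˢ J).filter fun ij => ij.2 < ij.1).card else 0

lemma gmul_mono (a b c d : ℤ) (I J : Finset (Fin 4)) :
    gmul (mono a b I) (mono c d J) = (prodSign I J : ℂ) • mono (a + c) (b + d) (I ∪ J) := by
  refine P4.ext fun K => ?_
  change gmulFun _ _ K = (prodSign I J : ℂ) • mono (a + c) (b + d) (I ∪ J) K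
  rw [gmulFun_apply, mono_apply]
  by_cases hK : Disjoint I J ∧ K = I ∪ J
  · obtain ⟨hd, rfl⟩ := hK
    have hs : (I ∪ J) \ I = J := by
      rw [Finset.union_sdiff_left, Finset.sdiff_eq_self_of_disjoint hd.symm]
    rw [Finset.sum_eq_single I]
    · simp [hs, mono_apply, monoP_mul, prodSign, hd, shuffleSign]
    · intro I' _ hI'
      simp [mono_apply, hI']
    · intro h
      exact absurd (Finset.mem_powerset.2 Finset.subset_union_left) h
  · have h0 : (prodSign I J : ℂ) • (if K = I ∪ J then monoP (a + c) (b + d) else 0) = 0 := by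
      by_cases hd : Disjoint I J
      · rw [if_neg fun h => hK ⟨hd, h⟩, smul_zero]
      · simp [prodSign, hd]
    rw [h0]
    refine Finset.sum_eq_zero fun I' hI' => ?_
    by_cases h1 : I' = I
    · by_cases h2 : K \ I' = J
      · exfalso
        subst h1 h2
        exact hK ⟨Finset.disjoint_sdiff, (Finset.union_sdiff_of_subset
          (Finset.mem_powerset.1 hI')).symm⟩
      · simp [mono_apply, h2]
    · simp [mono_apply, h1]

/-- The odd variable paired with `i`. -/
def dual (i : Fin 4) : Fin 4 := i + 2

/-- The odd part of the bracket of the ordered monomials on `I` and `J`: a list of terms, each a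
coefficient and a set of odd variables. -/
def oddTerms (I J : Finset (Fin 4)) : List (ℤ × Finset (Fin 4)) :=
  (List.finRange 4).map fun i =>
    (if i ∈ I ∧ dual i ∈ J then
      -(-1) ^ I.card * derivSign i I * derivSign (dual i) J * prodSign (I.erase i) (J.erase (dual i))
      else 0, I.erase i ∪ J.erase (dual i))

lemma gmul_dodd_mono (i : Fin 4) (a b c d : ℤ) (I J : Finset (Fin 4)) :
    -gmul (dodd i (parityInv (mono a b I))) (dodd (dual i) (mono c d J)) =
      ((if i ∈ I ∧ dual i ∈ J then
        -(-1) ^ I.card * derivSign i I * derivSign (dual i) J *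
          prodSign (I.erase i) (J.erase (dual i)) else 0 : ℤ) : ℂ) •
        mono (a + c) (b + d) (I.erase i ∪ J.erase (dual i)) := by
  rw [parityInv_mono, map_smul]
  by_cases hi : i ∈ I
  · by_cases hj : dual i ∈ J
    · rw [dodd_mono_of_mem hi, dodd_mono_of_mem hj, if_pos ⟨hi, hj⟩]
      simp only [map_smul, LinearMap.smul_apply, gmul_mono, smul_smul, ← neg_smul]
      push_cast
      congr 1; ring
    · rw [dodd_mono_of_notMem hj, if_neg fun h => hj h.2]; simp
  · rw [dodd_mono_of_notMem hi, if_neg fun h => hi h.1]; simp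

/-- Since `dual` exchanges `ξᵢ` and `ηᵢ`, the two odd sums of the Poisson bracket become one sum
over the four odd variables. The sign `(-1)^(p(A)+1)` is split between `parityInv` and the leading
minus. -/
lemma br_mono (a b c d : ℤ) (I J : Finset (Fin 4)) :
    poisson.br (mono a b I) (mono c d J) =
      (((b * c - a * d) * prodSign I J : ℤ) : ℂ) • mono (a + c - 1) (b + d - 1) (I ∪ J) +
      ((oddTerms I J).map fun t => (t.1 : ℂ) • mono (a + c) (b + d) t.2).sum := by
  have h : poisson.br (mono a b I) (mono c d J) =
      (gmul (dtau (mono a b I)) (dt (mono c d J)) - gmul (dt (mono a b I)) (dtau (mono c d J))) +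
      ((-gmul (dodd 0 (parityInv (mono a b I))) (dodd (dual 0) (mono c d J))) +
      ((-gmul (dodd 1 (parityInv (mono a b I))) (dodd (dual 1) (mono c d J))) +
      ((-gmul (dodd 2 (parityInv (mono a b I))) (dodd (dual 2) (mono c d J))) +
      (-gmul (dodd 3 (parityInv (mono a b I))) (dodd (dual 3) (mono c d J)))))) := by
    simp only [poisson, LinearMap.sub_apply, LinearMap.compl₁₂_apply, Fin.sum_univ_two,
      LinearMap.add_apply, LinearMap.comp_apply]
    have e0 : xiIdx 0 = 0 := rfl
    have e1 : xiIdx 1 = 1 := rfl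
    have e2 : etaIdx 0 = 2 := rfl
    have e3 : etaIdx 1 = 3 := rfl
    have d0 : dual 0 = 2 := rfl
    have d1 : dual 1 = 3 := rfl
    have d2 : dual 2 = 0 := rfl
    have d3 : dual 3 = 1 := rfl
    rw [e0, e1, e2, e3, d0, d1, d2, d3]
    abel
  rw [h]
  congr 1
  · simp only [dt_mono, dtau_mono, map_smul, LinearMap.smul_apply, gmul_mono, smul_smul]
    rw [show a + (c - 1) = a + c - 1 by ring, show b - 1 + d = b + d - 1 by ring,
      show a - 1 + c = a + c - 1 by ring, show b + (d - 1) = b + d - 1 by ring, ← sub_smul]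
    push_cast
    congr 1; ring
  · simp only [gmul_dodd_mono]
    simp only [oddTerms, show List.finRange 4 = [0, 1, 2, 3] from rfl, List.map_cons,
      List.map_nil, List.sum_cons, List.sum_nil, add_zero]

/-! ### Polynomial elements of `P(4)` as finitely supported functions -/

/-- Exponents `(a, b, I)` of the monomial `tᵃ τᵇ ξ_I`. -/
abbrev Mon := ℤ × ℤ × Finset (Fin 4)

/-- The free space on the monomials. -/
abbrev Free := Mon →₀ ℂ

/-- The bracket of two monomials: a list of terms, each a coefficient and a monomial. -/
def brTerms (x y : Mon) : List (ℤ × Mon) :=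
  ((x.2.1 * y.1 - x.1 * y.2.1) * prodSign x.2.2 y.2.2,
    (x.1 + y.1 - 1, x.2.1 + y.2.1 - 1, x.2.2 ∪ y.2.2)) ::
  (oddTerms x.2.2 y.2.2).map fun t => (t.1, (x.1 + y.1, x.2.1 + y.2.1, t.2))

/-- The sum of a list of terms. -/
noncomputable def sumTerms (l : List (ℤ × Mon)) : Free :=
  (l.map fun t => Finsupp.single t.2 (t.1 : ℂ)).sum

/-- The Poisson bracket on polynomial elements. -/
noncomputable def brFree : Free →ₗ[ℂ] Free →ₗ[ℂ] Free :=
  Finsupp.linearCombination ℂ fun x => Finsupp.linearCombination ℂ fun y => sumTerms (brTerms x y)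

lemma brFree_single (x y : Mon) (a b : ℂ) :
    brFree (Finsupp.single x a) (Finsupp.single y b) = (a * b) • sumTerms (brTerms x y) := by
  simp [brFree, Finsupp.linearCombination_single, smul_smul]

/-- The inclusion of the polynomial elements into `P(4)`. -/
noncomputable def ofFree : Free →ₗ[ℂ] P4 :=
  Finsupp.linearCombination ℂ fun x => mono x.1 x.2.1 x.2.2

lemma ofFree_single (x : Mon) (a : ℂ) : ofFree (Finsupp.single x a) = a • mono x.1 x.2.1 x.2.2 := by
  simp [ofFree]

lemma ofFree_sumTerms_brTerms (x y : Mon) :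
    ofFree (sumTerms (brTerms x y)) =
      poisson.br (mono x.1 x.2.1 x.2.2) (mono y.1 y.2.1 y.2.2) := by
  rw [br_mono, sumTerms, map_list_sum, brTerms]
  simp only [List.map_cons, List.map_map, List.sum_cons, ofFree_single]
  congr 3
  funext t
  simp [ofFree_single]

/-- This, together with the injectivity of `ofFree`, lets every later identity be checked on
finitely supported functions. -/
lemma ofFree_brFree (f g : Free) : ofFree (brFree f g) = poisson.br (ofFree f) (ofFree g) := by
  induction f using Finsupp.induction_linear with
  | zero => simp
  | add f f' hf hf' => simp only [map_add, LinearMap.add_apply, hf, hf']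
  | single x a =>
    induction g using Finsupp.induction_linear with
    | zero => simp
    | add g g' hg hg' => simp only [map_add, hg, hg']
    | single y b =>
      rw [brFree_single, map_smul, ofFree_sumTerms_brTerms, ofFree_single, ofFree_single,
        map_smul, map_smul, LinearMap.smul_apply, smul_smul, mul_comm]

/-- The coefficient of the monomial `x`. -/
noncomputable def monCoeff (x : Mon) : P4 →ₗ[ℂ] ℂ where
  toFun A := ((A x.2.2).tauCoeff x.2.1).coeff x.1
  map_add' A B := by rw [P4.add_apply, P.tauCoeff_add, AddMonoidAlgebra.coeff_add]; rfl
  map_smul' a A := by rw [P4.smul_apply, P.tauCoeff_smul, AddMonoidAlgebra.coeff_smul]; rfl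

lemma monCoeff_mono (x y : Mon) :
    monCoeff x (mono y.1 y.2.1 y.2.2) = if y = x then 1 else 0 := by
  obtain ⟨a, b, I⟩ := x
  obtain ⟨c, d, J⟩ := y
  change ((mono c d J I).tauCoeff b).coeff a = _
  rw [mono_apply]
  by_cases hI : I = J
  · rw [if_pos hI, tauCoeff_monoP]
    by_cases hb : b = d
    · rw [if_pos hb]
      change (Finsupp.single c (1 : ℂ)) a = _
      rw [Finsupp.single_apply]
      simp [hI, hb]
    · rw [if_neg hb, if_neg (by rintro ⟨⟩; exact hb rfl)]; rfl
  · rw [if_neg hI, if_neg (by rintro ⟨⟩; exact hI rfl)]; rfl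

lemma monCoeff_ofFree (x : Mon) (f : Free) : monCoeff x (ofFree f) = f x := by
  induction f using Finsupp.induction_linear with
  | zero => simp
  | add f f' hf hf' => simp only [map_add, hf, hf', Finsupp.add_apply]
  | single y a => rw [ofFree_single, map_smul, monCoeff_mono, Finsupp.single_apply]; simp

lemma ofFree_injective : Function.Injective ofFree := fun f g h => by
  ext x
  rw [← monCoeff_ofFree, h, monCoeff_ofFree]

lemma mem_poisson_part_iff (p : ZMod 2) (A : P4) :
    A ∈ poisson.part p ↔ ∀ I : Finset (Fin 4), (I.card : ZMod 2) ≠ p → A I = 0 := by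
  simp [poisson, Submodule.mem_iInf, LinearMap.mem_ker, P4.coeff_apply]

/-- The parity of a monomial. -/
def Mon.parity (x : Mon) : ZMod 2 := x.2.2.card

lemma ofFree_mem_part_iff (p : ZMod 2) (f : Free) :
    ofFree f ∈ poisson.part p ↔ ∀ x : Mon, x.parity ≠ p → f x = 0 := by
  rw [mem_poisson_part_iff]
  constructor
  · intro h x hx
    rw [← monCoeff_ofFree]
    change ((ofFree f x.2.2).tauCoeff x.2.1).coeff x.1 = 0
    rw [h _ hx]; rfl
  · intro h I hI
    refine P.ext_tauCoeff fun b => ?_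
    ext a
    exact (monCoeff_ofFree (a, b, I) f).trans (h (a, b, I) hI)

/-! ### Degree and weight -/

/-- The degree of a monomial. -/
def Mon.degree (x : Mon) : ℤ := x.1 + x.2.1 + x.2.2.card

/-- The weight of the ordered monomial on `I` for `5 ξ₁η₁ + ξ₂η₂`. -/
def oddWeight (I : Finset (Fin 4)) : ℤ := ∑ i ∈ I, ![5, 1, -5, -1] i

/-- The weight of a monomial for `30 tτ + 5 ξ₁η₁ + ξ₂η₂`. -/
def Mon.weight (x : Mon) : ℤ := 30 * (x.1 - x.2.1) + oddWeight x.2.2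

lemma oddWeight_union_of_prodSign : ∀ I J : Finset (Fin 4), prodSign I J ≠ 0 →
    oddWeight (I ∪ J) = oddWeight I + oddWeight J ∧ (I ∪ J).card = I.card + J.card := by
  intro I J h
  have hd : Disjoint I J := by
    by_contra hd
    exact h (if_neg hd)
  exact ⟨Finset.sum_union hd, Finset.card_union_of_disjoint hd⟩

/-- A contraction removes one variable from each factor, and the two removed variables are dual, so
their weights cancel. -/
lemma oddWeight_of_mem_oddTerms : ∀ I J : Finset (Fin 4), ∀ t ∈ oddTerms I J, t.1 ≠ 0 →
    oddWeight t.2 = oddWeight I + oddWeight J ∧ t.2.card + 2 = I.card + J.card := by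
  decide +kernel

/-- Both kinds of terms remove a conjugate pair: `t` and `τ`, of weights 30 and -30, or two dual odd
variables. Hence weights add and the degree drops by two. -/
lemma weight_of_mem_brTerms {x y : Mon} {t : ℤ × Mon} (ht : t ∈ brTerms x y) (h0 : t.1 ≠ 0) :
    t.2.weight = x.weight + y.weight ∧ t.2.degree = x.degree + y.degree - 2 := by
  rw [brTerms, List.mem_cons, List.mem_map] at ht
  rcases ht with rfl | ⟨s, hs, rfl⟩
  · have := oddWeight_union_of_prodSign x.2.2 y.2.2 (by rintro h; simp [h] at h0)
    simp only [Mon.weight, Mon.degree, this]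
    push_cast
    constructor <;> ring
  · have := oddWeight_of_mem_oddTerms _ _ s hs h0
    simp only [Mon.weight, Mon.degree, this.1]
    constructor
    · ring
    · have := this.2
      omega

/-- The diagonal operator with eigenvalue `φ x` on the monomial `x`. -/
noncomputable def diag (φ : Mon → ℂ) : Free →ₗ[ℂ] Free :=
  Finsupp.linearCombination ℂ fun x => Finsupp.single x (φ x)

lemma diag_single (φ : Mon → ℂ) (x : Mon) (a : ℂ) :
    diag φ (Finsupp.single x a) = Finsupp.single x (φ x * a) := by
  simp [diag, mul_comm]

lemma diag_apply (φ : Mon → ℂ) (f : Free) (x : Mon) : diag φ f x = φ x * f x := by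
  induction f using Finsupp.induction_linear with
  | zero => simp
  | add f f' hf hf' => simp only [map_add, Finsupp.add_apply, hf, hf', mul_add]
  | single y a =>
    rw [diag_single, Finsupp.single_apply, Finsupp.single_apply]
    split_ifs with h
    · rw [h]
    · simp

/-- The projection to the weight space of weight `w`. -/
noncomputable def weightProj (w : ℤ) : Free →ₗ[ℂ] Free :=
  diag fun x => if x.weight = w then 1 else 0

lemma weightProj_apply (w : ℤ) (f : Free) (x : Mon) :
    weightProj w f x = if x.weight = w then f x else 0 := by
  rw [weightProj, diag_apply]; split_ifs <;> simp

/-- The coefficient of `x` in a list of terms. -/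
def termCoeff {ι : Type*} [DecidableEq ι] (l : List (ℤ × ι)) (x : ι) : ℤ :=
  (l.map fun t => if t.2 = x then t.1 else 0).sum

lemma sumTerms_apply (l : List (ℤ × Mon)) (x : Mon) :
    sumTerms l x = (termCoeff l x : ℂ) := by
  rw [termCoeff]
  induction l with
  | nil => simp [sumTerms]
  | cons t l ih =>
    rw [sumTerms] at ih ⊢
    rw [List.map_cons, List.sum_cons, Finsupp.add_apply, ih, List.map_cons, List.sum_cons,
      Finsupp.single_apply]
    split_ifs <;> simp

lemma exists_mem_of_sumTerms_ne_zero {l : List (ℤ × Mon)} {x : Mon} (h : sumTerms l x ≠ 0) :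
    ∃ t ∈ l, t.1 ≠ 0 ∧ t.2 = x := by
  by_contra! hl
  refine h ?_
  rw [sumTerms_apply, termCoeff, List.sum_eq_zero, Int.cast_zero]
  intro z hz
  obtain ⟨t, ht, rfl⟩ := List.mem_map.1 hz
  split_ifs with htx
  · by_contra h0
    exact hl t ht h0 htx
  · rfl

lemma weight_of_brTerms_apply_ne_zero {x y m : Mon} (h : sumTerms (brTerms x y) m ≠ 0) :
    m.weight = x.weight + y.weight ∧ m.degree = x.degree + y.degree - 2 := by
  obtain ⟨t, ht, h0, rfl⟩ := exists_mem_of_sumTerms_ne_zero h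
  exact weight_of_mem_brTerms ht h0

lemma weightProj_brFree_single (x : Mon) (a : ℂ) (w : ℤ) (g : Free) :
    weightProj (x.weight + w) (brFree (Finsupp.single x a) g) =
      brFree (Finsupp.single x a) (weightProj w g) := by
  induction g using Finsupp.induction_linear with
  | zero => simp
  | add g g' hg hg' => simp only [map_add, hg, hg']
  | single y b =>
    rw [brFree_single, weightProj, weightProj, diag_single, brFree_single]
    ext m
    rw [diag_apply, Finsupp.smul_apply, Finsupp.smul_apply]
    by_cases h : sumTerms (brTerms x y) m = 0
    · simp [h]
    · have := (weight_of_brTerms_apply_ne_zero h).1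
      have : m.weight = x.weight + w ↔ y.weight = w := by omega
      simp only [this]
      split_ifs <;> simp

lemma weightProj_brFree {f : Free} {v : ℤ} (hf : ∀ x ∈ f.support, x.weight = v) (w : ℤ) (g : Free) :
    weightProj (v + w) (brFree f g) = brFree f (weightProj w g) := by
  have h : f = ∑ x ∈ f.support, Finsupp.single x (f x) := f.sum_single.symm
  rw [h]
  simp only [map_sum, LinearMap.sum_apply]
  refine Finset.sum_congr rfl fun x hx => ?_
  rw [← hf x hx, weightProj_brFree_single]

/-! ### The torus element -/

/-- The element `30 tτ + 5 ξ₁η₁ + ξ₂η₂`, whose adjoint action is diagonal with eigenvalues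
`Mon.weight`. -/
noncomputable def torusElt : Free :=
  (30 : ℂ) • Finsupp.single (1, 1, ∅) 1 + (5 : ℂ) • Finsupp.single (0, 0, {0, 2}) 1 +
    Finsupp.single (0, 0, {1, 3}) 1

/-- The element `ξᵢηᵢ` acts on an odd monomial by the number of factors `ξᵢ` minus the number of
factors `ηᵢ`. -/
lemma oddTerms_torus : ∀ J K : Finset (Fin 4),
    termCoeff (oddTerms ∅ J) K = 0 ∧
    termCoeff (oddTerms {0, 2} J) K * 5 +
      termCoeff (oddTerms {1, 3} J) K =
        if J = K then oddWeight J else 0 := by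
  decide +kernel

lemma sumTerms_brTerms_apply (x y m : Mon) :
    sumTerms (brTerms x y) m =
      (if (x.1 + y.1 - 1, x.2.1 + y.2.1 - 1, x.2.2 ∪ y.2.2) = m then
        (((x.2.1 * y.1 - x.1 * y.2.1) * prodSign x.2.2 y.2.2 : ℤ) : ℂ) else 0) +
      if x.1 + y.1 = m.1 ∧ x.2.1 + y.2.1 = m.2.1 then
        ((termCoeff (oddTerms x.2.2 y.2.2) m.2.2 : ℤ) : ℂ)
        else 0 := by
  rw [sumTerms_apply, termCoeff, brTerms, List.map_cons, List.sum_cons, List.map_map, Int.cast_add]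
  congr 1
  · split_ifs <;> simp
  · obtain ⟨a, b, K⟩ := m
    split_ifs with h
    · simp [h, Function.comp_def, termCoeff]
    · rw [List.sum_eq_zero, Int.cast_zero]
      intro z hz
      obtain ⟨t, ht, rfl⟩ := List.mem_map.1 hz
      refine if_neg fun h' => h ?_
      simp only [Prod.mk.injEq] at h'
      exact ⟨h'.1, h'.2.1⟩

lemma prodSign_empty (J : Finset (Fin 4)) : prodSign ∅ J = 1 := by
  simp [prodSign]

lemma brFree_torusElt (f : Free) : brFree torusElt f = diag (fun x => x.weight) f := by
  induction f using Finsupp.induction_linear with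
  | zero => simp
  | add g g' hg hg' => simp only [map_add, hg, hg']
  | single y b =>
    simp only [torusElt, map_add, map_smul, LinearMap.add_apply, LinearMap.smul_apply,
      brFree_single, diag_single]
    obtain ⟨c, d, J⟩ := y
    ext ⟨a', b', K⟩
    have h := oddTerms_torus J K
    have h2 := congrArg (Int.cast : ℤ → ℂ) h.2
    push_cast at h2
    simp only [Finsupp.add_apply, Finsupp.smul_apply, sumTerms_brTerms_apply, h.1,
      Finsupp.single_apply, prodSign_empty, Mon.weight]
    by_cases hm : c = a' ∧ d = b'
    · obtain ⟨rfl, rfl⟩ := hm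
      by_cases hJ : J = K
      · subst hJ
        simp only [if_true] at h2
        simp
        linear_combination b * h2
      · simp only [hJ, if_false] at h2
        simp [hJ]
        linear_combination b * h2
    · have h3 : ¬(c = a' ∧ d = b' ∧ J = K) := fun h => hm ⟨h.1, h.2.1⟩
      simp [hm, h3]

/-! ### The derived algebra `K'(4)` -/

/-- The exponents of `c₃ = t⁻¹ τ⁻¹ ξ₁ ξ₂ η₁ η₂`. -/
def topMon : Mon := (-1, -1, {0, 1, 2, 3})

/-- The monomials in `K'(4)`: those of degree two except `c₃`. -/
def derivedMons : Set Mon := {x | x.degree = 2 ∧ x ≠ topMon}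

/-- Single contractions can reach the top form, but their contributions cancel: no odd bracket has a
component of top degree. -/
lemma oddTerms_top : ∀ I J : Finset (Fin 4),
    termCoeff (oddTerms I J) {0, 1, 2, 3} = 0 := by
  decide +kernel

/-- A residue argument. To reach `t⁻¹τ⁻¹` the even exponents of the factors must be opposite, and
then the determinant in front of the even term vanishes. -/
lemma sumTerms_brTerms_topMon (x y : Mon) : sumTerms (brTerms x y) topMon = 0 := by
  rw [sumTerms_brTerms_apply]
  simp only [topMon, oddTerms_top, Int.cast_zero, ite_self, add_zero]
  split_ifs with h
  · simp only [Prod.mk.injEq] at h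
    rw [show y.1 = -x.1 by omega, show y.2.1 = -x.2.1 by omega]
    ring_nf
    simp
  · exact if_neg h

lemma K4_eq : K4 = (Finsupp.supported ℂ ℂ {x : Mon | x.degree = 2}).map ofFree := by
  rw [Finsupp.supported_eq_span_single, Submodule.map_span, K4, degreePart]
  congr 1
  ext A
  constructor
  · rintro ⟨a, b, I, h, rfl⟩
    exact ⟨_, ⟨(a, b, I), h, rfl⟩, by rw [ofFree_single, one_smul]⟩
  · rintro ⟨_, ⟨x, h, rfl⟩, rfl⟩
    exact ⟨x.1, x.2.1, x.2.2, h, by rw [ofFree_single, one_smul]⟩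

lemma brFree_mem_derived {f g : Free} (hf : f ∈ Finsupp.supported ℂ ℂ {x : Mon | x.degree = 2})
    (hg : g ∈ Finsupp.supported ℂ ℂ {x : Mon | x.degree = 2}) :
    brFree f g ∈ Finsupp.supported ℂ ℂ derivedMons := by
  rw [Finsupp.supported_eq_span_single] at hf hg
  induction hf, hg using Submodule.span_induction₂ with
  | mem_mem f g hf hg =>
    obtain ⟨x, hx, rfl⟩ := hf
    obtain ⟨y, hy, rfl⟩ := hg
    rw [brFree_single]
    refine Submodule.smul_mem _ _ ?_
    rw [Finsupp.mem_supported]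
    intro m hm
    rw [Finset.mem_coe, Finsupp.mem_support_iff] at hm
    refine ⟨?_, ?_⟩
    · have := (weight_of_brTerms_apply_ne_zero hm).2
      simp only [Set.mem_ofPred_eq] at hx hy
      omega
    · rintro rfl
      exact hm (sumTerms_brTerms_topMon x y)
  | zero_left => simp
  | zero_right => simp
  | add_left _ _ _ _ _ _ h1 h2 => rw [map_add]; exact Submodule.add_mem _ h1 h2
  | add_right _ _ _ _ _ _ h1 h2 => rw [map_add]; exact Submodule.add_mem _ h1 h2
  | smul_left _ _ _ _ _ h1 => rw [map_smul]; exact Submodule.smul_mem _ _ h1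
  | smul_right _ _ _ _ _ h1 => rw [map_smul]; exact Submodule.smul_mem _ _ h1

lemma br_mem_K4' {f g : Free} (hf : f ∈ Finsupp.supported ℂ ℂ {x : Mon | x.degree = 2})
    (hg : g ∈ Finsupp.supported ℂ ℂ {x : Mon | x.degree = 2}) : ofFree (brFree f g) ∈ K4' := by
  rw [ofFree_brFree]
  exact Submodule.subset_span ⟨_, K4_eq ▸ Submodule.mem_map_of_mem hf, _,
    K4_eq ▸ Submodule.mem_map_of_mem hg, rfl⟩

lemma torusElt_mem : torusElt ∈ Finsupp.supported ℂ ℂ {x : Mon | x.degree = 2} := by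
  refine Submodule.add_mem _ (Submodule.add_mem _ (Submodule.smul_mem _ _ ?_)
    (Submodule.smul_mem _ _ ?_)) ?_ <;> exact Finsupp.single_mem_supported _ _ (by decide)

/-- The bound 6 is well below 30, so a multiple of 30 in the weight cannot be compensated by odd
variables. The coefficients 5 and 1 keep the two odd torus directions apart. -/
lemma oddWeight_cases : ∀ I : Finset (Fin 4), -6 ≤ oddWeight I ∧ oddWeight I ≤ 6 ∧
    (oddWeight I = 0 → I = ∅ ∨ I = {0, 2} ∨ I = {1, 3} ∨ I = {0, 1, 2, 3}) := by
  decide +kernel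

/-- Two lists of terms have the same sum if the coefficients agree at all monomials in them. -/
lemma sumTerms_eq_sumTerms {l l' : List (ℤ × Mon)}
    (h : ∀ s ∈ l ++ l', termCoeff l s.2 =
      termCoeff l' s.2) : sumTerms l = sumTerms l' := by
  ext x
  by_cases hx : ∃ s ∈ l ++ l', s.2 = x
  · obtain ⟨s, hs, rfl⟩ := hx
    rw [sumTerms_apply, sumTerms_apply, h s hs]
  · push Not at hx
    have h1 : sumTerms l x = 0 := by
      by_contra h0
      obtain ⟨t, ht, -, h2⟩ := exists_mem_of_sumTerms_ne_zero h0
      exact hx t (List.mem_append_left _ ht) h2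
    have h2 : sumTerms l' x = 0 := by
      by_contra h0
      obtain ⟨t, ht, -, h2⟩ := exists_mem_of_sumTerms_ne_zero h0
      exact hx t (List.mem_append_right _ ht) h2
    rw [h1, h2]

lemma weight_zero_cases {x : Mon} (hx : x ∈ derivedMons) (hw : x.weight = 0) :
    x = (1, 1, ∅) ∨ x = (0, 0, {0, 2}) ∨ x = (0, 0, {1, 3}) := by
  obtain ⟨a, b, I⟩ := x
  obtain ⟨hd, ht⟩ := hx
  have h := oddWeight_cases I
  simp only [Mon.weight, Mon.degree] at hw hd
  have hI : oddWeight I = 0 := by omega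
  rcases h.2.2 hI with rfl | rfl | rfl | rfl
  · left
    simp only [Finset.card_empty] at hd
    simp only [Prod.mk.injEq, and_true]
    omega
  · right; left
    rw [show ({0, 2} : Finset (Fin 4)).card = 2 from rfl] at hd
    simp only [Prod.mk.injEq, and_true]
    omega
  · right; right
    rw [show ({1, 3} : Finset (Fin 4)).card = 2 from rfl] at hd
    simp only [Prod.mk.injEq, and_true]
    omega
  · rw [show ({0, 1, 2, 3} : Finset (Fin 4)).card = 4 from rfl] at hd
    refine absurd ?_ ht
    simp only [topMon, Prod.mk.injEq, and_true]
    omega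

/-- A monomial of nonzero weight is a multiple of its own bracket with the torus element. Only the
three monomials of weight zero need explicit brackets. -/
lemma ofFree_single_mem_K4' {x : Mon} (hx : x ∈ derivedMons) :
    ofFree (Finsupp.single x 1) ∈ K4' := by
  have single_mem : ∀ y : Mon, y.degree = 2 →
      Finsupp.single y (1 : ℂ) ∈ Finsupp.supported ℂ ℂ {x : Mon | x.degree = 2} :=
    fun y hy => Finsupp.single_mem_supported _ _ hy
  by_cases hw : x.weight = 0
  · rcases weight_zero_cases hx hw with rfl | rfl | rfl
    · have h : brFree (Finsupp.single (0, 2, ∅) 1) (Finsupp.single (2, 0, ∅) 1) =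
          (4 : ℂ) • Finsupp.single (1, 1, ∅) 1 := by
        rw [brFree_single, sumTerms_eq_sumTerms (l' := [(4, (1, 1, ∅))]) (by decide +kernel)]
        simp [sumTerms]
      have := br_mem_K4' (single_mem (0, 2, ∅) (by decide)) (single_mem (2, 0, ∅) (by decide))
      rw [h, map_smul] at this
      exact (Submodule.smul_mem_iff _ (by norm_num)).1 this
    -- The brackets of two pairs of opposite root vectors give `ξ₁η₁ + ξ₂η₂` and `ξ₁η₁ - ξ₂η₂`; half
    -- the sum and half the difference are the two monomials.
    all_goals
      have h1 : brFree (Finsupp.single (0, 0, {2, 3}) 1) (Finsupp.single (0, 0, {0, 1}) 1) =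
          Finsupp.single (0, 0, {0, 2}) 1 + Finsupp.single (0, 0, {1, 3}) 1 := by
        rw [brFree_single, sumTerms_eq_sumTerms (l' := [(1, (0, 0, {0, 2})), (1, (0, 0, {1, 3}))])
          (by decide +kernel)]
        simp [sumTerms]
      have h2 : brFree (Finsupp.single (0, 0, {0, 3}) 1) (Finsupp.single (0, 0, {1, 2}) 1) =
          Finsupp.single (0, 0, {0, 2}) 1 - Finsupp.single (0, 0, {1, 3}) 1 := by
        rw [brFree_single, sumTerms_eq_sumTerms (l' := [(1, (0, 0, {0, 2})), (-1, (0, 0, {1, 3}))])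
          (by decide +kernel)]
        simp [sumTerms, sub_eq_add_neg]
      have m1 := br_mem_K4' (single_mem (0, 0, {2, 3}) (by decide))
        (single_mem (0, 0, {0, 1}) (by decide))
      have m2 := br_mem_K4' (single_mem (0, 0, {0, 3}) (by decide))
        (single_mem (0, 0, {1, 2}) (by decide))
      rw [h1] at m1
      rw [h2] at m2
    · convert Submodule.smul_mem _ (1 / 2 : ℂ) (Submodule.add_mem _ m1 m2) using 1
      rw [← map_add, ← map_smul]
      congr 1
      module
    · convert Submodule.smul_mem _ (1 / 2 : ℂ) (Submodule.sub_mem _ m1 m2) using 1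
      rw [← map_sub, ← map_smul]
      congr 1
      module
  · have := br_mem_K4' torusElt_mem (single_mem x hx.1)
    rw [brFree_torusElt, diag_single, ← smul_eq_mul, ← Finsupp.smul_single, map_smul] at this
    exact (Submodule.smul_mem_iff _ (by exact_mod_cast hw)).1 this

/-- In particular all values of a cocycle are polynomial, and membership in `K'(4)` is a condition
on supports. -/
lemma K4'_eq : K4' = (Finsupp.supported ℂ ℂ derivedMons).map ofFree := by
  refine le_antisymm ?_ ?_
  · refine Submodule.span_le.2 ?_
    rintro _ ⟨A, hA, B, hB, rfl⟩
    rw [K4_eq] at hA hB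
    obtain ⟨f, hf, rfl⟩ := hA
    obtain ⟨g, hg, rfl⟩ := hB
    exact ⟨_, brFree_mem_derived hf hg, ofFree_brFree f g⟩
  · rw [Finsupp.supported_eq_span_single, Submodule.map_span, Submodule.span_le]
    rintro _ ⟨_, ⟨x, hx, rfl⟩, rfl⟩
    exact ofFree_single_mem_K4' hx

/-! ### Coordinates on `Γ(2, -1 - α, α - 1)` -/

/-- A numbering of the labels. -/
def Gen.index : Gen → Fin 17
  | .E1 => 0 | .F1 => 1 | .H1 => 2 | .E2 => 3 | .F2 => 4 | .H2 => 5 | .E3 => 6 | .F3 => 7 | .H3 => 8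
  | .T1 => 9 | .T2 => 10 | .T3 => 11 | .T4 => 12 | .D1 => 13 | .D2 => 14 | .D3 => 15 | .D4 => 16

/-- The list of all labels. -/
def Gen.all : List Gen :=
  [.E1, .F1, .H1, .E2, .F2, .H2, .E3, .F3, .H3, .T1, .T2, .T3, .T4, .D1, .D2, .D3, .D4]

lemma Gen.all_get_index (g : Gen) : Gen.all[g.index] = g := by cases g <;> rfl

instance : DecidableEq Gen := fun a b => decidable_of_iff (a.index = b.index)
  ⟨fun h => by rw [← Gen.all_get_index a, ← Gen.all_get_index b]; exact congrArg _ h, congrArg _⟩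

lemma Gen.mem_all (g : Gen) : g ∈ Gen.all := by
  rw [← Gen.all_get_index g]; exact List.getElem_mem _

instance : Fintype Gen := ⟨⟨Gen.all, by decide⟩, Gen.mem_all⟩

lemma sum_gen {M : Type*} [AddCommMonoid M] (f : Gen → M) :
    ∑ g, f g = (Gen.all.map f).sum := rfl

/-- The parity of the basis elements of `Γ_α`. -/
def Gen.parity : Gen → ZMod 2
  | .T1 | .T2 | .T3 | .T4 | .D1 | .D2 | .D3 | .D4 => 1
  | _ => 0

/-- The factor `√2 i` in the definition of `ρ_α`. -/
noncomputable def oddScale : ℂ := (Real.sqrt 2 : ℂ) * Complex.I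

lemma oddScale_mul_self : oddScale * oddScale = -2 := by
  have h : ((Real.sqrt 2 : ℝ) : ℂ) * (Real.sqrt 2 : ℝ) = 2 := by
    rw [← Complex.ofReal_mul, Real.mul_self_sqrt (by norm_num)]; norm_num
  rw [oddScale]
  linear_combination Complex.I * Complex.I * h + 2 * Complex.I_mul_I

lemma oddScale_ne_zero : oddScale ≠ 0 := fun h => by
  have := oddScale_mul_self
  simp [h] at this

lemma sp_apply_one_one (m : Sp) : m.1 1 1 = -m.1 0 0 := by
  have h := m.2
  rw [mem_skewAdjointMatricesLieSubalgebra, mem_skewAdjointMatricesSubmodule] at h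
  have h01 := congrFun (congrFun h 0) 1
  simp [psiMat, Matrix.mul_apply, Fin.sum_univ_two] at h01
  linear_combination h01

/-- The element of `sp(ψ)` with the given matrix entries. -/
def mkSp (a b c : ℂ) : Sp :=
  ⟨!![a, b; c, -a], by
    rw [mem_skewAdjointMatricesLieSubalgebra, mem_skewAdjointMatricesSubmodule]
    ext i j
    fin_cases i <;> fin_cases j <;> simp [psiMat, Matrix.mul_apply, Fin.sum_univ_two]⟩

lemma mkSp_eta (m : Sp) : mkSp (m.1 0 0) (m.1 0 1) (m.1 1 0) = m := by
  refine Subtype.ext ?_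
  ext i j
  fin_cases i <;> fin_cases j <;> simp [mkSp, sp_apply_one_one]

/-- The coordinates of an element of `Γ(2, -1 - α, α - 1)` in the basis that corresponds to that of
`Γ_α`, except that the labels `H2` and `H3` stand for `ξ₁η₁` and `ξ₂η₂`. -/
noncomputable def coordFun (X : GammaSpace) : Gen → ℂ
  | .E1 => -(X.1.1.1 0 1 / 2)
  | .F1 => X.1.1.1 1 0 / 2
  | .H1 => X.1.1.1 0 0
  | .E2 => X.1.2.1.1 1 0
  | .F2 => -X.1.2.1.1 0 1
  | .H2 => -X.1.2.1.1 0 0 - X.1.2.2.1 0 0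
  | .E3 => -X.1.2.2.1 1 0
  | .F3 => -X.1.2.2.1 0 1
  | .H3 => -X.1.2.1.1 0 0 + X.1.2.2.1 0 0
  | .T1 => oddScale * X.2 0 0 0
  | .T2 => oddScale * X.2 0 0 1
  | .T3 => oddScale * X.2 0 1 1
  | .T4 => -(oddScale * X.2 0 1 0)
  | .D1 => oddScale * X.2 1 1 1
  | .D2 => -(oddScale * X.2 1 1 0)
  | .D3 => oddScale * X.2 1 0 0
  | .D4 => oddScale * X.2 1 0 1

/-- The coordinates as a linear equivalence. -/
noncomputable def coord : GammaSpace ≃ₗ[ℂ] (Gen → ℂ) where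
  toFun := coordFun
  map_add' X Y := by
    funext k
    cases k <;> simp [coordFun] <;> ring
  map_smul' a X := by
    funext k
    cases k <;> simp [coordFun] <;> ring
  invFun x :=
    ((mkSp (x .H1) (-2 * x .E1) (2 * x .F1),
      mkSp (-(x .H2 + x .H3) / 2) (-x .F2) (x .E2),
      mkSp ((x .H3 - x .H2) / 2) (-x .F3) (-x .E3)),
      ![![![oddScale⁻¹ * x .T1, oddScale⁻¹ * x .T2], ![-(oddScale⁻¹ * x .T4), oddScale⁻¹ * x .T3]],
        ![![oddScale⁻¹ * x .D3, oddScale⁻¹ * x .D4],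
          ![-(oddScale⁻¹ * x .D2), oddScale⁻¹ * x .D1]]])
  left_inv X := by
    have h := oddScale_ne_zero
    refine Prod.ext (Prod.ext ?_ (Prod.ext ?_ ?_)) ?_
    · conv_rhs => rw [← mkSp_eta X.1.1]
      simp only [coordFun]
      congr 1 <;> ring
    · conv_rhs => rw [← mkSp_eta X.1.2.1]
      simp only [coordFun]
      congr 1 <;> ring
    · conv_rhs => rw [← mkSp_eta X.1.2.2]
      simp only [coordFun]
      congr 1 <;> ring
    · ext i j k
      fin_cases i <;> fin_cases j <;> fin_cases k <;> simp [coordFun, h]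
  right_inv x := by
    have h := oddScale_ne_zero
    funext k
    cases k <;> simp [coordFun, mkSp, h] <;> ring

/-- The part of the bracket of `Γ(2, -1 - α, α - 1)` that does not depend on `α`, in coordinates. -/
def coordBr₀ {R : Type*} [Add R] [Sub R] [Mul R] [OfNat R 2] [OfNat R 4] (x y : Gen → R) : Gen → R
  | .E1 => 2 * (x .H1 * y .E1 - x .E1 * y .H1) +
      (x .T1 * y .T3 + x .T2 * y .T4 + x .T3 * y .T1 + x .T4 * y .T2)
  | .F1 => 2 * (x .F1 * y .H1 - x .H1 * y .F1) +
      (x .D1 * y .D3 + x .D2 * y .D4 + x .D3 * y .D1 + x .D4 * y .D2)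
  | .H1 => 4 * (x .F1 * y .E1 - x .E1 * y .F1) +
      (x .T1 * y .D1 + x .T2 * y .D2 + x .T3 * y .D3 + x .T4 * y .D4) +
      (x .D1 * y .T1 + x .D2 * y .T2 + x .D3 * y .T3 + x .D4 * y .T4)
  | .E2 => (x .H2 + x .H3) * y .E2 - x .E2 * (y .H2 + y .H3) +
      (x .T4 * y .D1 - x .T3 * y .D2 + x .D1 * y .T4 - x .D2 * y .T3)
  | .F2 => x .F2 * (y .H2 + y .H3) - (x .H2 + x .H3) * y .F2 +
      (x .T2 * y .D3 - x .T1 * y .D4 + x .D3 * y .T2 - x .D4 * y .T1)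
  | .H2 => x .F2 * y .E2 - x .E2 * y .F2 + x .E3 * y .F3 - x .F3 * y .E3 +
      (x .T1 * y .D1 - x .T3 * y .D3 + x .D1 * y .T1 - x .D3 * y .T3)
  | .E3 => (x .H2 - x .H3) * y .E3 - x .E3 * (y .H2 - y .H3) +
      (x .T2 * y .D1 - x .T3 * y .D4 + x .D1 * y .T2 - x .D4 * y .T3)
  | .F3 => x .F3 * (y .H2 - y .H3) - (x .H2 - x .H3) * y .F3 +
      (x .T1 * y .D2 - x .T4 * y .D3 + x .D2 * y .T1 - x .D3 * y .T4)
  | .H3 => x .F2 * y .E2 - x .E2 * y .F2 - x .E3 * y .F3 + x .F3 * y .E3 +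
      (x .T2 * y .D2 - x .T4 * y .D4 + x .D2 * y .T2 - x .D4 * y .T4)
  | .T1 => 2 * (x .D3 * y .E1 - x .E1 * y .D3) + (x .H1 - x .H2) * y .T1 - x .T1 * (y .H1 - y .H2) +
      x .F2 * y .T4 - x .T4 * y .F2 - x .F3 * y .T2 + x .T2 * y .F3
  | .T2 => 2 * (x .D4 * y .E1 - x .E1 * y .D4) + (x .H1 - x .H3) * y .T2 - x .T2 * (y .H1 - y .H3) -
      x .F2 * y .T3 + x .T3 * y .F2 - x .E3 * y .T1 + x .T1 * y .E3
  | .T3 => 2 * (x .D1 * y .E1 - x .E1 * y .D1) + (x .H1 + x .H2) * y .T3 - x .T3 * (y .H1 + y .H2) +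
      x .E2 * y .T2 - x .T2 * y .E2 + x .E3 * y .T4 - x .T4 * y .E3
  | .T4 => 2 * (x .D2 * y .E1 - x .E1 * y .D2) + (x .H1 + x .H3) * y .T4 - x .T4 * (y .H1 + y .H3) -
      x .E2 * y .T1 + x .T1 * y .E2 + x .F3 * y .T3 - x .T3 * y .F3
  | .D1 => 2 * (x .F1 * y .T3 - x .T3 * y .F1) + (x .H2 - x .H1) * y .D1 - x .D1 * (y .H2 - y .H1) +
      x .E2 * y .D4 - x .D4 * y .E2 + x .E3 * y .D2 - x .D2 * y .E3
  | .D2 => 2 * (x .F1 * y .T4 - x .T4 * y .F1) + (x .H3 - x .H1) * y .D2 - x .D2 * (y .H3 - y .H1) -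
      x .E2 * y .D3 + x .D3 * y .E2 + x .F3 * y .D1 - x .D1 * y .F3
  | .D3 => 2 * (x .F1 * y .T1 - x .T1 * y .F1) - (x .H1 + x .H2) * y .D3 + x .D3 * (y .H1 + y .H2) +
      x .F2 * y .D2 - x .D2 * y .F2 - x .F3 * y .D4 + x .D4 * y .F3
  | .D4 => 2 * (x .F1 * y .T2 - x .T2 * y .F1) - (x .H1 + x .H3) * y .D4 + x .D4 * (y .H1 + y .H3) -
      x .F2 * y .D1 + x .D1 * y .F2 - x .E3 * y .D3 + x .D3 * y .E3

/-- The coefficient of `α` in the bracket of `Γ(2, -1 - α, α - 1)`, in coordinates. -/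
def coordBr₁ {R : Type*} [Zero R] [Add R] [Sub R] [Mul R] (x y : Gen → R) : Gen → R
  | .E2 => x .T4 * y .D1 - x .T3 * y .D2 + x .D1 * y .T4 - x .D2 * y .T3
  | .F2 => x .T2 * y .D3 - x .T1 * y .D4 + x .D3 * y .T2 - x .D4 * y .T1
  | .H2 => x .T2 * y .D2 - x .T4 * y .D4 + x .D2 * y .T2 - x .D4 * y .T4
  | .E3 => x .T3 * y .D4 - x .T2 * y .D1 + x .D4 * y .T3 - x .D1 * y .T2
  | .F3 => x .T4 * y .D3 - x .T1 * y .D2 + x .D3 * y .T4 - x .D2 * y .T1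
  | .H3 => x .T1 * y .D1 - x .T3 * y .D3 + x .D1 * y .T1 - x .D3 * y .T3
  | _ => 0

lemma sp_lie_apply (m n : Sp) :
    ⁅m, n⁆.1 0 0 = m.1 0 1 * n.1 1 0 - m.1 1 0 * n.1 0 1 ∧
    ⁅m, n⁆.1 0 1 = 2 * (m.1 0 0 * n.1 0 1 - m.1 0 1 * n.1 0 0) ∧
    ⁅m, n⁆.1 1 0 = 2 * (m.1 1 0 * n.1 0 0 - m.1 0 0 * n.1 1 0) := by
  have h : ⁅m, n⁆.1 = m.1 * n.1 - n.1 * m.1 := rfl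
  refine ⟨?_, ?_, ?_⟩ <;>
    simp [h, Matrix.mul_apply, Fin.sum_univ_two, sp_apply_one_one] <;> ring

lemma spMap_stdVec_apply (i j k l : Fin 2) : (spMap (stdVec i) (stdVec j)).1 k l =
    psi (stdVec j) (stdVec l) * stdVec i k - psi (stdVec l) (stdVec i) * stdVec j k := rfl

lemma psi_stdVec : psi (stdVec 0) (stdVec 0) = 0 ∧ psi (stdVec 0) (stdVec 1) = 1 ∧
    psi (stdVec 1) (stdVec 0) = -1 ∧ psi (stdVec 1) (stdVec 1) = 0 := by
  simp [psi_eq, stdVec]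

lemma oddBracket_fst_apply (σ₁ σ₂ σ₃ : ℂ) (u v : GammaOdd) (k l : Fin 2) :
    (oddBracket σ₁ σ₂ σ₃ u v).1.1 k l =
      σ₁ * ∑ i, ∑ j, (u i 0 0 * v j 1 1 - u i 0 1 * v j 1 0 - u i 1 0 * v j 0 1 + u i 1 1 * v j 0 0) *
        (spMap (stdVec i) (stdVec j)).1 k l := by
  obtain ⟨h0, h1, h2, h3⟩ := psi_stdVec
  simp [oddBracket, oddBasisBracket, Fin.sum_univ_two, h0, h1, h2, h3]
  ring

lemma oddBracket_snd_fst_apply (σ₁ σ₂ σ₃ : ℂ) (u v : GammaOdd) (k l : Fin 2) :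
    (oddBracket σ₁ σ₂ σ₃ u v).2.1.1 k l =
      σ₂ * ∑ i, ∑ j, (u 0 i 0 * v 1 j 1 - u 0 i 1 * v 1 j 0 - u 1 i 0 * v 0 j 1 + u 1 i 1 * v 0 j 0) *
        (spMap (stdVec i) (stdVec j)).1 k l := by
  obtain ⟨h0, h1, h2, h3⟩ := psi_stdVec
  simp [oddBracket, oddBasisBracket, Fin.sum_univ_two, h0, h1, h2, h3]
  ring

lemma oddBracket_snd_snd_apply (σ₁ σ₂ σ₃ : ℂ) (u v : GammaOdd) (k l : Fin 2) :
    (oddBracket σ₁ σ₂ σ₃ u v).2.2.1 k l =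
      σ₃ * ∑ i, ∑ j, (u 0 0 i * v 1 1 j - u 0 1 i * v 1 0 j - u 1 0 i * v 0 1 j + u 1 1 i * v 0 0 j) *
        (spMap (stdVec i) (stdVec j)).1 k l := by
  obtain ⟨h0, h1, h2, h3⟩ := psi_stdVec
  simp [oddBracket, oddBasisBracket, Fin.sum_univ_two, h0, h1, h2, h3]
  ring

lemma coord_apply (X : GammaSpace) (k : Gen) : coord X k = coordFun X k := rfl

lemma gammaAlpha_br (α : ℂ) (X Y : GammaSpace) : (gammaAlpha α).br X Y =
    (⁅X.1, Y.1⁆ + oddBracket 2 (-1 - α) (α - 1) X.2 Y.2, act X.1 Y.2 - act Y.1 X.2) := rfl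

/-- Entrywise comparison, using that elements of `sp(ψ)` have trace zero. The odd coordinates carry
the factor `√2 i`, whose square -2 is what makes the odd-odd structure constants integral. -/
lemma coord_br (α : ℂ) (X Y : GammaSpace) (k : Gen) :
    coord ((gammaAlpha α).br X Y) k =
      coordBr₀ (coord X) (coord Y) k + α * coordBr₁ (coord X) (coord Y) k := by
  obtain ⟨⟨m₁, m₂, m₃⟩, u⟩ := X
  obtain ⟨⟨n₁, n₂, n₃⟩, v⟩ := Y
  obtain ⟨h0, h1, h2, h3⟩ := psi_stdVec
  have e1 := sp_lie_apply m₁ n₁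
  have e2 := sp_lie_apply m₂ n₂
  have e3 := sp_lie_apply m₃ n₃
  have f1 : ∀ i j, (⁅((m₁, m₂, m₃) : GammaEven), (n₁, n₂, n₃)⁆ +
      oddBracket 2 (-1 - α) (α - 1) u v).1.1 i j =
      ⁅m₁, n₁⁆.1 i j + (oddBracket 2 (-1 - α) (α - 1) u v).1.1 i j := fun i j => rfl
  have f2 : ∀ i j, (⁅((m₁, m₂, m₃) : GammaEven), (n₁, n₂, n₃)⁆ +
      oddBracket 2 (-1 - α) (α - 1) u v).2.1.1 i j =
      ⁅m₂, n₂⁆.1 i j + (oddBracket 2 (-1 - α) (α - 1) u v).2.1.1 i j := fun i j => rfl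
  have f3 : ∀ i j, (⁅((m₁, m₂, m₃) : GammaEven), (n₁, n₂, n₃)⁆ +
      oddBracket 2 (-1 - α) (α - 1) u v).2.2.1 i j =
      ⁅m₃, n₃⁆.1 i j + (oddBracket 2 (-1 - α) (α - 1) u v).2.2.1 i j := fun i j => rfl
  have hs : oddScale ^ 2 = -2 := by rw [pow_two, oddScale_mul_self]
  have c0 : ∀ i : Fin 2, stdVec i i = 1 := fun i => by simp [stdVec]
  have c1 : stdVec 0 1 = 0 := by simp [stdVec]
  have c2 : stdVec 1 0 = 0 := by simp [stdVec]
  have hm₁ := sp_apply_one_one m₁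
  have hm₂ := sp_apply_one_one m₂
  have hm₃ := sp_apply_one_one m₃
  have hn₁ := sp_apply_one_one n₁
  have hn₂ := sp_apply_one_one n₂
  have hn₃ := sp_apply_one_one n₃
  cases k <;>
  simp only [coord_apply, gammaAlpha_br, coordFun, coordBr₀, coordBr₁, f1, f2, f3, e1, e2, e3,
    oddBracket_fst_apply, oddBracket_snd_fst_apply, oddBracket_snd_snd_apply, Fin.sum_univ_two,
    spMap_stdVec_apply, h0, h1, h2, h3, c0, c1, c2, act, Pi.sub_apply, hm₁, hm₂, hm₃, hn₁, hn₂,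
    hn₃] <;> ring_nf <;> simp only [hs] <;> ring

/-! ### The family `ρ_α + βθ` -/

/-- The part of the basis of `Γ_α` that does not depend on `α`; the labels `H2` and `H3` stand for
`ξ₁η₁` and `ξ₂η₂`. -/
def genTerms₀ : Gen → List (ℤ × Mon)
  | .E1 => [(1, 2, 0, ∅)]
  | .F1 => [(1, 0, 2, ∅)]
  | .H1 => [(1, 1, 1, ∅)]
  | .E2 => [(1, 0, 0, {0, 1})]
  | .F2 => [(1, 0, 0, {2, 3})]
  | .H2 => [(1, 0, 0, {0, 2})]
  | .E3 => [(1, 0, 0, {0, 3})]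
  | .F3 => [(1, 0, 0, {1, 2})]
  | .H3 => [(1, 0, 0, {1, 3})]
  | .T1 => [(1, 1, 0, {2})]
  | .T2 => [(1, 1, 0, {3})]
  | .T3 => [(1, 1, 0, {0})]
  | .T4 => [(1, 1, 0, {1})]
  | .D1 => [(1, 0, 1, {0})]
  | .D2 => [(1, 0, 1, {1})]
  | .D3 => [(1, 0, 1, {2})]
  | .D4 => [(1, 0, 1, {3})]

/-- The coefficient of `α` in the basis of `Γ_α`. -/
def genTerms₁ : Gen → List (ℤ × Mon)
  | .F1 => [(-2, -2, 0, {0, 1, 2, 3})]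
  | .D1 => [(1, -1, 0, {0, 1, 3})]
  | .D2 => [(-1, -1, 0, {0, 1, 2})]
  | .D3 => [(1, -1, 0, {1, 2, 3})]
  | .D4 => [(-1, -1, 0, {0, 2, 3})]
  | _ => []

/-- The values of `θ`. -/
def thetaTerms : Gen → List (ℤ × Mon)
  | .T1 => [(1, 0, -1, {1, 2, 3})]
  | .T2 => [(-1, 0, -1, {0, 2, 3})]
  | .T3 => [(1, 0, -1, {0, 1, 3})]
  | .T4 => [(-1, 0, -1, {0, 1, 2})]
  | .D1 => [(1, -1, 0, {0, 1, 3})]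
  | .D2 => [(-1, -1, 0, {0, 1, 2})]
  | .D3 => [(1, -1, 0, {1, 2, 3})]
  | .D4 => [(-1, -1, 0, {0, 2, 3})]
  | .E1 => [(2, 0, -2, {0, 1, 2, 3})]
  | .F1 => [(-2, -2, 0, {0, 1, 2, 3})]
  | _ => []

/-- The basis of `Γ_α`. -/
noncomputable def elt (α : ℂ) (g : Gen) : Free := sumTerms (genTerms₀ g) + α • sumTerms (genTerms₁ g)

/-- The values of `θ` on the basis of `Γ_α`. -/
noncomputable def thetaElt (g : Gen) : Free := sumTerms (thetaTerms g)

/-! ### Computing brackets and linear combinations on lists of terms -/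

lemma sumTerms_append (l l' : List (ℤ × Mon)) : sumTerms (l ++ l') = sumTerms l + sumTerms l' := by
  simp [sumTerms]

lemma sumTerms_cons (t : ℤ × Mon) (l : List (ℤ × Mon)) :
    sumTerms (t :: l) = Finsupp.single t.2 (t.1 : ℂ) + sumTerms l := by
  simp [sumTerms]

lemma sumTerms_nil : sumTerms [] = 0 := rfl

lemma sumTerms_flatMap {ι : Type*} (l : List ι) (F : ι → List (ℤ × Mon)) :
    sumTerms (l.flatMap F) = (l.map fun i => sumTerms (F i)).sum := by
  induction l with
  | nil => rfl
  | cons i l ih => rw [List.flatMap_cons, sumTerms_append, ih, List.map_cons, List.sum_cons]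

/-- Multiply a list of terms by an integer and drop the zero terms. -/
def smulTerms (c : ℤ) (l : List (ℤ × Mon)) : List (ℤ × Mon) :=
  if c = 0 then [] else (l.filter fun t => t.1 ≠ 0).map fun t => (c * t.1, t.2)

lemma sumTerms_smulTerms (c : ℤ) (l : List (ℤ × Mon)) :
    sumTerms (smulTerms c l) = (c : ℂ) • sumTerms l := by
  rw [smulTerms]
  split_ifs with h
  · simp [h, sumTerms_nil]
  · clear h
    induction l with
    | nil => simp [sumTerms_nil]
    | cons t l ih =>
      rw [List.filter_cons]
      split_ifs with ht
      · rw [List.map_cons, sumTerms_cons, sumTerms_cons, ih]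
        simp
      · rw [ih, sumTerms_cons]
        simp_all

/-- The bracket of two sums of terms. -/
def brLists (l l' : List (ℤ × Mon)) : List (ℤ × Mon) :=
  l.flatMap fun s => l'.flatMap fun t => smulTerms (s.1 * t.1) (brTerms s.2 t.2)

lemma sumTerms_brLists (l l' : List (ℤ × Mon)) :
    sumTerms (brLists l l') = brFree (sumTerms l) (sumTerms l') := by
  rw [brLists, sumTerms_flatMap]
  induction l with
  | nil => simp [sumTerms_nil]
  | cons s l ih =>
    rw [List.map_cons, List.sum_cons, ih, sumTerms_cons, map_add, LinearMap.add_apply]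
    congr 1
    clear ih
    rw [sumTerms_flatMap]
    induction l' with
    | nil => simp [sumTerms_nil]
    | cons t l' ih' =>
      rw [List.map_cons, List.sum_cons, ih', sumTerms_cons, map_add, sumTerms_smulTerms,
        brFree_single, Int.cast_mul]

/-- A linear combination of sums of terms, indexed by the labels. -/
def combLists (c : Gen → ℤ) (v : Gen → List (ℤ × Mon)) : List (ℤ × Mon) :=
  Gen.all.flatMap fun k => smulTerms (c k) (v k)

lemma sumTerms_combLists (c : Gen → ℤ) (v : Gen → List (ℤ × Mon)) :
    sumTerms (combLists c v) = ∑ k, (c k : ℂ) • sumTerms (v k) := by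
  rw [combLists, sumTerms_flatMap, sum_gen]
  simp only [sumTerms_smulTerms]

/-- The structure constants of `Γ(2, -1 - α, α - 1)` that do not depend on `α`. -/
def struct₀ (g h : Gen) : Gen → ℤ := 
  coordBr₀ (fun k => if k = g then 1 else 0) (fun k => if k = h then 1 else 0)

/-- The coefficients of `α` in the structure constants of `Γ(2, -1 - α, α - 1)`. -/
def struct₁ (g h : Gen) : Gen → ℤ := 
  coordBr₁ (fun k => if k = g then 1 else 0) (fun k => if k = h then 1 else 0)

/-- The coefficients of the two sums of terms agree. -/
def TermsEq (l l' : List (ℤ × Mon)) : Prop :=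
  ∀ s ∈ l ++ l', termCoeff l s.2 = termCoeff l' s.2

instance (l l' : List (ℤ × Mon)) : Decidable (TermsEq l l') := by
  unfold TermsEq; infer_instance

/-- The three clauses are the coefficients of `1`, `α` and `α²` in the identity that expresses
`[X_g, X_h]` through the basis. -/
lemma genTerms_brLists : ∀ g h : Gen,
    TermsEq (brLists (genTerms₀ g) (genTerms₀ h)) (combLists (struct₀ g h) genTerms₀) ∧
    TermsEq (brLists (genTerms₀ g) (genTerms₁ h) ++ brLists (genTerms₁ g) (genTerms₀ h))
      (combLists (struct₀ g h) genTerms₁ ++ combLists (struct₁ g h) genTerms₀) ∧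
    TermsEq (brLists (genTerms₁ g) (genTerms₁ h)) (combLists (struct₁ g h) genTerms₁) := by
  decide +kernel

/-- For `ρ_α + βθ` these are the coefficients of `β`, `αβ` and `β²` in the homomorphism identity. -/
lemma thetaTerms_brLists : ∀ g h : Gen,
    TermsEq (brLists (genTerms₀ g) (thetaTerms h) ++ brLists (thetaTerms g) (genTerms₀ h))
      (combLists (struct₀ g h) thetaTerms) ∧
    TermsEq (brLists (genTerms₁ g) (thetaTerms h) ++ brLists (thetaTerms g) (genTerms₁ h))
      (combLists (struct₁ g h) thetaTerms) ∧
    TermsEq (brLists (thetaTerms g) (thetaTerms h)) [] := by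
  decide +kernel

/-- The `α`-corrections of the basis commute with `c₃`; this is why the values of `θ` do not depend
on `α`. -/
lemma thetaTerms_eq_brLists : ∀ g : Gen,
    TermsEq (brLists (genTerms₀ g) [(1, topMon)]) (thetaTerms g) ∧
    TermsEq (brLists (genTerms₁ g) [(1, topMon)]) [] := by
  decide +kernel

/-- The structure constants of `Γ(2, -1 - α, α - 1)`. -/
noncomputable def struct (α : ℂ) (g h k : Gen) : ℂ := struct₀ g h k + α * struct₁ g h k

lemma brFree_elt (α : ℂ) (g h : Gen) :
    brFree (elt α g) (elt α h) = ∑ k, struct α g h k • elt α k := by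
  obtain ⟨h0, h1, h2⟩ := genTerms_brLists g h
  have h0 := sumTerms_eq_sumTerms h0
  have h1 := sumTerms_eq_sumTerms h1
  have h2 := sumTerms_eq_sumTerms h2
  simp only [sumTerms_append, sumTerms_brLists, sumTerms_combLists] at h0 h1 h2
  calc _ = brFree (sumTerms (genTerms₀ g)) (sumTerms (genTerms₀ h)) +
        α • (brFree (sumTerms (genTerms₀ g)) (sumTerms (genTerms₁ h)) +
          brFree (sumTerms (genTerms₁ g)) (sumTerms (genTerms₀ h))) +
        (α * α) • brFree (sumTerms (genTerms₁ g)) (sumTerms (genTerms₁ h)) := by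
        simp only [elt, map_add, map_smul, LinearMap.add_apply, LinearMap.smul_apply]
        module
    _ = _ := by
        rw [h0, h1, h2, smul_add, Finset.smul_sum, Finset.smul_sum, Finset.smul_sum]
        simp only [← Finset.sum_add_distrib]
        refine Finset.sum_congr rfl fun k _ => ?_
        rw [struct, elt]
        module

lemma brFree_elt_thetaElt (α : ℂ) (g h : Gen) :
    brFree (elt α g) (thetaElt h) + brFree (thetaElt g) (elt α h) =
      ∑ k, struct α g h k • thetaElt k := by
  obtain ⟨h0, h1, -⟩ := thetaTerms_brLists g h
  have h0 := sumTerms_eq_sumTerms h0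
  have h1 := sumTerms_eq_sumTerms h1
  simp only [sumTerms_append, sumTerms_brLists, sumTerms_combLists] at h0 h1
  calc _ = (brFree (sumTerms (genTerms₀ g)) (sumTerms (thetaTerms h)) +
          brFree (sumTerms (thetaTerms g)) (sumTerms (genTerms₀ h))) +
        α • (brFree (sumTerms (genTerms₁ g)) (sumTerms (thetaTerms h)) +
          brFree (sumTerms (thetaTerms g)) (sumTerms (genTerms₁ h))) := by
        simp only [elt, thetaElt, map_add, map_smul, LinearMap.add_apply, LinearMap.smul_apply]
        module
    _ = _ := by
        rw [h0, h1, Finset.smul_sum]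
        simp only [← Finset.sum_add_distrib]
        refine Finset.sum_congr rfl fun k _ => ?_
        rw [struct, thetaElt]
        module

lemma brFree_thetaElt (g h : Gen) : brFree (thetaElt g) (thetaElt h) = 0 := by
  rw [thetaElt, thetaElt, ← sumTerms_brLists, sumTerms_eq_sumTerms (thetaTerms_brLists g h).2.2,
    sumTerms_nil]

lemma thetaElt_eq (α : ℂ) (g : Gen) :
    thetaElt g = brFree (elt α g) (Finsupp.single topMon 1) := by
  have h : Finsupp.single topMon (1 : ℂ) = sumTerms [(1, topMon)] := by simp [sumTerms]
  obtain ⟨h0, h1⟩ := thetaTerms_eq_brLists g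
  rw [h, elt, map_add, map_smul, LinearMap.add_apply, LinearMap.smul_apply, ← sumTerms_brLists,
    ← sumTerms_brLists, sumTerms_eq_sumTerms h0, sumTerms_eq_sumTerms h1, sumTerms_nil, smul_zero,
    add_zero, thetaElt]

/-! ### The basis of `Γ(2, -1 - α, α - 1)` -/

/-- The basis of `Γ(2, -1 - α, α - 1)` with coordinates `coord`. -/
noncomputable def gammaBasis : Module.Basis Gen ℂ GammaSpace := Module.Basis.ofEquivFun coord

lemma coord_gammaBasis (g : Gen) : coord (gammaBasis g) = Pi.single g 1 := by
  simp [gammaBasis]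

lemma sum_coord_smul (X : GammaSpace) : ∑ g, coord X g • gammaBasis g = X :=
  gammaBasis.sum_equivFun X

/-- The same formulas are read over `ℤ` and over `ℂ`, so that structure constants can be evaluated
as integers. -/
lemma coordBr_intCast (x y : Gen → ℤ) (k : Gen) :
    coordBr₀ (fun g => (x g : ℂ)) (fun g => (y g : ℂ)) k = (coordBr₀ x y k : ℤ) ∧
    coordBr₁ (fun g => (x g : ℂ)) (fun g => (y g : ℂ)) k = (coordBr₁ x y k : ℤ) := by
  cases k <;> simp [coordBr₀, coordBr₁]

lemma coord_br_gammaBasis (α : ℂ) (g h k : Gen) :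
    coord ((gammaAlpha α).br (gammaBasis g) (gammaBasis h)) k = struct α g h k := by
  have e : ∀ g : Gen, (Pi.single g 1 : Gen → ℂ) = fun k => ((if k = g then 1 else 0 : ℤ) : ℂ) := by
    intro g
    funext k
    by_cases h : k = g
    · subst h; simp
    · simp [h]
  rw [coord_br, coord_gammaBasis, coord_gammaBasis, e g, e h, (coordBr_intCast _ _ k).1,
    (coordBr_intCast _ _ k).2]
  rfl

lemma br_gammaBasis (α : ℂ) (g h : Gen) :
    (gammaAlpha α).br (gammaBasis g) (gammaBasis h) = ∑ k, struct α g h k • gammaBasis k := by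
  rw [← sum_coord_smul ((gammaAlpha α).br (gammaBasis g) (gammaBasis h))]
  simp only [coord_br_gammaBasis]

/-- Here the elements `H_α²`, `H_α³` of the statement, a sum and a difference, are exchanged for
`ξ₁η₁` and `ξ₂η₂`, which avoids halves in the structure constants. -/
lemma fromGen_eq_sum {W : Type*} [AddCommGroup W] [Module ℂ W] (v v' : Gen → W)
    (h2 : v .H2 = v' .H2 + v' .H3) (h3 : v .H3 = v' .H2 - v' .H3)
    (h : ∀ g, g ≠ .H2 → g ≠ .H3 → v g = v' g) (X : GammaSpace) :
    fromGen v X = ∑ g, coord X g • v' g := by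
  have hs : (Real.sqrt 2 : ℂ) * Complex.I = oddScale := rfl
  simp only [sum_gen, Gen.all, List.map_cons, List.map_nil, List.sum_cons, List.sum_nil,
    coord_apply, coordFun, fromGen, LinearMap.coe_mk, AddHom.coe_mk, h2, h3, hs]
  simp only [h, ne_eq, reduceCtorEq, not_false_eq_true]
  module

lemma rho_eq_sum (α : ℂ) (X : GammaSpace) : rho α X = ∑ g, coord X g • ofFree (elt α g) := by
  refine fromGen_eq_sum _ _ ?_ ?_ (fun g _ _ => ?_) X
  · simp [elt, genTerms₀, genTerms₁, sumTerms, ofFree_single, gen]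
  · simp [elt, genTerms₀, genTerms₁, sumTerms, ofFree_single, gen]
  · cases g <;>
      simp_all [elt, genTerms₀, genTerms₁, sumTerms_cons, sumTerms_nil, ofFree_single, gen,
        -Finsupp.smul_single] <;>
      module

lemma theta_eq_sum (X : GammaSpace) : theta X = ∑ g, coord X g • ofFree (thetaElt g) := by
  refine fromGen_eq_sum _ _ ?_ ?_ (fun g _ _ => ?_) X
  · simp [thetaElt, thetaTerms, sumTerms, thetaVal]
  · simp [thetaElt, thetaTerms, sumTerms, thetaVal]
  · cases g <;> simp [thetaElt, thetaTerms, sumTerms, ofFree_single, thetaVal]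

lemma rho_gammaBasis (α : ℂ) (g : Gen) : rho α (gammaBasis g) = ofFree (elt α g) := by
  rw [rho_eq_sum, Finset.sum_eq_single g] <;> simp +contextual [coord_gammaBasis]

lemma theta_gammaBasis (g : Gen) : theta (gammaBasis g) = ofFree (thetaElt g) := by
  rw [theta_eq_sum, Finset.sum_eq_single g] <;> simp +contextual [coord_gammaBasis]

/-! ### Cocycles with polynomial values -/

/-- The weights of the basis elements of `Γ_α` for `30 tτ + 5 ξ₁η₁ + ξ₂η₂`. -/
def Gen.weight : Gen → ℤ
  | .E1 => 60 | .F1 => -60 | .E2 => 6 | .F2 => -6 | .E3 => 4 | .F3 => -4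
  | .T1 => 25 | .T2 => 29 | .T3 => 35 | .T4 => 31 | .D1 => -25 | .D2 => -29 | .D3 => -35 | .D4 => -31
  | _ => 0

/-- The `α`-corrections and the values of `θ` have the same weight and parity as the leading terms,
so `Γ_α` is graded by weight for every `α` and `θ` preserves the grading. -/
lemma genTerms_homogeneous : ∀ g : Gen, ∀ t ∈ genTerms₀ g ++ genTerms₁ g ++ thetaTerms g,
    t.2.weight = g.weight ∧ (t.2.degree = 2 ∧ t.2 ≠ topMon) ∧ t.2.parity = g.parity := by
  decide +kernel

lemma elt_apply_ne_zero {α : ℂ} {g : Gen} {x : Mon} (h : elt α g x ≠ 0) :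
    x.weight = g.weight ∧ x ∈ derivedMons ∧ x.parity = g.parity := by
  rw [elt, Finsupp.add_apply, Finsupp.smul_apply] at h
  by_cases h0 : sumTerms (genTerms₀ g) x = 0
  · by_cases h1 : sumTerms (genTerms₁ g) x = 0
    · simp [h0, h1] at h
    · obtain ⟨t, ht, -, rfl⟩ := exists_mem_of_sumTerms_ne_zero h1
      exact genTerms_homogeneous g t (by simp [ht])
  · obtain ⟨t, ht, -, rfl⟩ := exists_mem_of_sumTerms_ne_zero h0
    exact genTerms_homogeneous g t (by simp [ht])

lemma thetaElt_apply_ne_zero {g : Gen} {x : Mon} (h : thetaElt g x ≠ 0) :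
    x.weight = g.weight ∧ x ∈ derivedMons ∧ x.parity = g.parity := by
  obtain ⟨t, ht, -, rfl⟩ := exists_mem_of_sumTerms_ne_zero h
  exact genTerms_homogeneous g t (by simp [ht])

lemma weightProj_brFree_elt (α : ℂ) (g : Gen) (w : ℤ) (f : Free) :
    weightProj (g.weight + w) (brFree (elt α g) f) = brFree (elt α g) (weightProj w f) :=
  weightProj_brFree (fun _ hx => (elt_apply_ne_zero (Finsupp.mem_support_iff.1 hx)).1) w f

lemma brFree_elt_apply (α : ℂ) (g : Gen) {w : ℤ} {m : Mon} (hm : m.weight = g.weight + w)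
    (f : Free) : brFree (elt α g) f m = brFree (elt α g) (weightProj w f) m := by
  rw [← weightProj_brFree_elt, weightProj_apply, if_pos hm]

/-- The 1-cocycles of parity `p` of `Γ_α` with values in polynomial elements of `K'(4)`, given by
their values on the basis. -/
structure IsFreeCocycle (α : ℂ) (p : ZMod 2) (z : Gen → Free) : Prop where
  mem : ∀ g, z g ∈ Finsupp.supported ℂ ℂ derivedMons
  parity : ∀ g x, x.parity ≠ p + g.parity → z g x = 0
  cocycle : ∀ g h, ksign p g.parity • brFree (elt α g) (z h) -
    ksign h.parity (p + g.parity) • brFree (elt α h) (z g) - ∑ k, struct α g h k • z k = 0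

lemma torusElt_eq (α : ℂ) : torusElt = (30 : ℂ) • elt α .H1 + (5 : ℂ) • elt α .H2 + elt α .H3 := by
  simp [torusElt, elt, genTerms₀, genTerms₁, sumTerms]

/-- The torus element also acts diagonally on `Γ_α`, by `Gen.weight` and without any dependence on
`α`. -/
lemma struct_torus : ∀ g k : Gen,
    30 * struct₀ .H1 g k + 5 * struct₀ .H2 g k + struct₀ .H3 g k =
      (if k = g then g.weight else 0) ∧
    struct₁ .H1 g k = 0 ∧ struct₁ .H2 g k = 0 ∧ struct₁ .H3 g k = 0 := by
  decide +kernel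

lemma ksign_zero_right (p : ZMod 2) : ksign p 0 = 1 := by simp [ksign]

lemma ksign_comm (p q : ZMod 2) : ksign p q = ksign q p := by simp [ksign, mul_comm]

namespace IsFreeCocycle

variable {α : ℂ} {p : ZMod 2} {z : Gen → Free}

/-- The value of a cocycle on the torus element. -/
noncomputable def torusValue (z : Gen → Free) : Free := (30 : ℂ) • z .H1 + (5 : ℂ) • z .H2 + z .H3

/-- This is the cocycle condition for the pair formed by the torus element and `g`: the torus acts
on values by the weight of `m` and on arguments by the weight of `g`. -/
lemma torus (hz : IsFreeCocycle α p z) (g : Gen) (m : Mon) :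
    ((m.weight : ℂ) - g.weight) * z g m =
      ksign p g.parity * brFree (elt α g) (torusValue z) m := by
  have h1 := hz.cocycle .H1 g
  have h2 := hz.cocycle .H2 g
  have h3 := hz.cocycle .H3 g
  have e : ∑ k, ((30 : ℂ) * struct α .H1 g k + 5 * struct α .H2 g k + struct α .H3 g k) • z k =
      (g.weight : ℂ) • z g := by
    rw [Finset.sum_eq_single g]
    · obtain ⟨s0, s1, s2, s3⟩ := struct_torus g g
      rw [if_pos rfl] at s0
      simp only [struct, s1, s2, s3, ← s0]
      push_cast
      congr 1
      ring
    · intro k _ hk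
      obtain ⟨s0, s1, s2, s3⟩ := struct_torus g k
      rw [if_neg hk] at s0
      have s0' := congrArg (Int.cast : ℤ → ℂ) s0
      push_cast at s0'
      have : (30 : ℂ) * struct α .H1 g k + 5 * struct α .H2 g k + struct α .H3 g k = 0 := by
        simp only [struct, s1, s2, s3]
        push_cast
        linear_combination s0'
      rw [this, zero_smul]
    · simp
  -- The torus is even, so only the sign of the coboundary survives.
  have hp : ∀ g' : Gen, g'.parity = 0 → ksign p g'.parity = 1 ∧
      ksign g.parity (p + g'.parity) = ksign p g.parity := fun g' h' => by
    rw [h', ksign_zero_right, add_zero, ksign_comm]; simp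
  rw [(hp .H1 rfl).1, (hp .H1 rfl).2, one_smul] at h1
  rw [(hp .H2 rfl).1, (hp .H2 rfl).2, one_smul] at h2
  rw [(hp .H3 rfl).1, (hp .H3 rfl).2, one_smul] at h3
  simp only [add_smul, mul_smul, Finset.sum_add_distrib, ← Finset.smul_sum] at e
  have key : diag (fun x => (x.weight : ℂ)) (z g) -
      ksign p g.parity • brFree (elt α g) (torusValue z) - (g.weight : ℂ) • z g = 0 := by
    rw [← brFree_torusElt, torusElt_eq α, ← e, torusValue]
    simp only [map_add, map_smul, LinearMap.add_apply, LinearMap.smul_apply]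
    linear_combination (norm := module) (30 : ℂ) • h1 + (5 : ℂ) • h2 + h3
  have := DFunLike.congr_fun key m
  simp only [Finsupp.sub_apply, Finsupp.smul_apply, diag_apply, smul_eq_mul,
    Finsupp.zero_apply] at this
  linear_combination this

/-- Up to a coboundary, a cocycle preserves weights. -/
lemma exists_eq_add_weightProj (hz : IsFreeCocycle α p z) :
    ∃ n ∈ Finsupp.supported ℂ ℂ derivedMons, (∀ x, x.parity ≠ p → n x = 0) ∧
      ∀ g, z g = ksign p g.parity • brFree (elt α g) n + weightProj g.weight (z g) := by
  -- The primitive divides the value on the torus element by the weights. At weight zero the inverse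
  -- is 0 by convention.
  refine ⟨diag (fun x => (x.weight : ℂ)⁻¹) (torusValue z), ?_, ?_, fun g => ?_⟩
  · have hv : torusValue z ∈ Finsupp.supported ℂ ℂ derivedMons :=
      Submodule.add_mem _ (Submodule.add_mem _ (Submodule.smul_mem _ _ (hz.mem _))
        (Submodule.smul_mem _ _ (hz.mem _))) (hz.mem _)
    rw [Finsupp.mem_supported'] at hv ⊢
    intro x hx
    rw [diag_apply, hv x hx, mul_zero]
  · intro x hx
    rw [diag_apply, torusValue]
    simp only [Finsupp.add_apply, Finsupp.smul_apply, hz.parity .H1 x (by simpa [Gen.parity]),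
      hz.parity .H2 x (by simpa [Gen.parity]), hz.parity .H3 x (by simpa [Gen.parity])]
    simp
  · ext m
    have hd : weightProj (m.weight - g.weight) (diag (fun x => (x.weight : ℂ)⁻¹) (torusValue z)) =
        ((m.weight : ℂ) - g.weight)⁻¹ • weightProj (m.weight - g.weight) (torusValue z) := by
      ext x
      rw [weightProj_apply, diag_apply, Finsupp.smul_apply, weightProj_apply]
      split_ifs with hx
      · rw [hx]; push_cast; rfl
      · simp
    have hm : m.weight = g.weight + (m.weight - g.weight) := by ring
    have hb := brFree_elt_apply α g hm (torusValue z)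
    have ht := hz.torus g m
    rw [Finsupp.add_apply, Finsupp.smul_apply, weightProj_apply, brFree_elt_apply α g hm, hd,
      map_smul, Finsupp.smul_apply, ← hb]
    -- If the weights agree, the factor `0⁻¹ = 0` kills the coboundary and the projection supplies
    -- the whole coefficient. Otherwise the projection is zero and the previous lemma can be divided
    -- by the weight difference.
    split_ifs with h
    · rw [h]; simp
    · have h0 : (m.weight : ℂ) - g.weight ≠ 0 := sub_ne_zero.2 (by exact_mod_cast h)
      rw [smul_eq_mul, smul_eq_mul, mul_left_comm, ← ht]
      field_simp
      simp

end IsFreeCocycle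

/-! ### Weight-preserving cocycles -/

lemma oddWeight_cast : ∀ I : Finset (Fin 4), (oddWeight I : ZMod 2) = (I.card : ZMod 2) := by
  decide +kernel

/-- The coefficient 30 is even while 5 and 1 are odd, so the weight modulo 2 counts odd variables.
-/
lemma Mon.weight_cast (x : Mon) : (x.weight : ZMod 2) = x.parity := by
  rw [Mon.weight, Mon.parity, Int.cast_add, oddWeight_cast, Int.cast_mul,
    show ((30 : ℤ) : ZMod 2) = 0 from rfl, zero_mul, zero_add]

lemma Gen.weight_cast (g : Gen) : (g.weight : ZMod 2) = g.parity := by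
  revert g; decide

/-- The subsets of the set of odd variables. -/
def oddSubsets : List (Finset (Fin 4)) := (List.finRange 4).sublists.map List.toFinset

lemma mem_oddSubsets : ∀ I : Finset (Fin 4), I ∈ oddSubsets := by decide +kernel

/-- The monomials in `K'(4)` that have the same weight as the basis element `g`. -/
def weightMons (g : Gen) : List Mon :=
  (oddSubsets.map fun I =>
    (((2 - I.card + (g.weight - oddWeight I) / 30) / 2,
      (2 - I.card - (g.weight - oddWeight I) / 30) / 2, I) : Mon)).filter
    fun x => x.weight = g.weight ∧ x.degree = 2 ∧ x ≠ topMon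

/-- Given the set of odd variables, the weight fixes the difference of the even exponents and the
degree fixes their sum. The integer divisions by 30 and 2 in the list are exact for such a monomial;
the filter removes the other candidates. -/
lemma mem_weightMons {g : Gen} {x : Mon} (hx : x ∈ derivedMons) (hw : x.weight = g.weight) :
    x ∈ weightMons g := by
  obtain ⟨a, b, I⟩ := x
  refine List.mem_filter.2 ⟨List.mem_map.2 ⟨I, mem_oddSubsets I, ?_⟩, by simp [hw, hx.1, hx.2]⟩
  have hd := hx.1
  simp only [Mon.weight, Mon.degree] at hw hd
  refine Prod.ext ?_ (Prod.ext ?_ rfl)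
  · change (2 - (I.card : ℤ) + (g.weight - oddWeight I) / 30) / 2 = a
    omega
  · change (2 - (I.card : ℤ) - (g.weight - oddWeight I) / 30) / 2 = b
    omega

lemma nodup_weightMons : ∀ g : Gen, (weightMons g).Nodup := by decide +kernel

lemma eq_sum_single_of_nodup {l : List Mon} (hl : l.Nodup) {f : Free} (hf : ∀ x, f x ≠ 0 → x ∈ l) :
    f = (l.map fun x => Finsupp.single x (f x)).sum := by
  have h : f.support ⊆ l.toFinset := fun x hx =>
    List.mem_toFinset.2 (hf x (Finsupp.mem_support_iff.1 hx))
  conv_lhs => rw [← f.sum_single, Finsupp.sum_of_support_subset f h _ (by simp)]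
  rw [List.sum_toFinset _ hl]

/-- The coefficients at `m` of the part of `[X, m']` which does not depend on `α`, and of the
coefficient of `α` in it, where `X` is the basis element `g` of `Γ_α`. -/
def adCoeff (g : Gen) (m' m : Mon) : ℤ × ℤ :=
  (termCoeff (brLists (genTerms₀ g) [(1, m')]) m, termCoeff (brLists (genTerms₁ g) [(1, m')]) m)

lemma brFree_elt_single (α : ℂ) (g : Gen) (m' m : Mon) (a : ℂ) :
    brFree (elt α g) (Finsupp.single m' a) m =
      ((adCoeff g m' m).1 + α * (adCoeff g m' m).2) * a := by
  have h : Finsupp.single m' a = a • sumTerms [(1, m')] := by simp [sumTerms]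
  rw [h, elt, map_smul, map_add, map_smul, LinearMap.add_apply, LinearMap.smul_apply,
    ← sumTerms_brLists, ← sumTerms_brLists, adCoeff]
  simp only [Finsupp.smul_apply, Finsupp.add_apply, sumTerms_apply, smul_eq_mul]
  ring

/-- A linear relation between the coefficients of a family `z` of elements: the term `(c, i, k, m)`
stands for `c αⁱ` times the coefficient of `m` in `z k`. -/
abbrev Relation := List (ℤ × ℕ × Gen × Mon)

/-- The value of the left hand side of a relation. -/
noncomputable def Relation.eval (α : ℂ) (z : Gen → Free) (l : Relation) : ℂ :=
  (l.map fun t => (t.1 : ℂ) * α ^ t.2.1 * z t.2.2.1 t.2.2.2).sum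

/-- The bracket of the basis element `g` with the weight-preserving part of `z h`, at `m`. -/
def adRelation (ε : ℤ) (g h : Gen) (m : Mon) : Relation :=
  (weightMons h).flatMap fun m' =>
    [(ε * (adCoeff g m' m).1, 0, h, m'), (ε * (adCoeff g m' m).2, 1, h, m')]

/-- The sign `-(-1)^(p(g) p(h))`. -/
def skewSign (g h : Gen) : ℤ := if g.parity = 1 ∧ h.parity = 1 then 1 else -1

lemma skewSign_cast (g h : Gen) : (skewSign g h : ℂ) = -ksign h.parity (0 + g.parity) := by
  have : ∀ a b : ZMod 2, (if a = 1 ∧ b = 1 then 1 else -1 : ℤ) =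
      -(-1) ^ (b.val * (0 + a).val) := by decide
  rw [skewSign, this, ksign]
  push_cast
  rfl

/-- The cocycle condition for the basis elements `g`, `h` at the monomial `m`. -/
def cocycleRelation (g h : Gen) (m : Mon) : Relation :=
  (adRelation 1 g h m ++ adRelation (skewSign g h) h g m ++
    Gen.all.flatMap fun k => [(-struct₀ g h k, 0, k, m), (-struct₁ g h k, 1, k, m)]).filter
    fun t => t.1 ≠ 0

lemma Relation.eval_append (α : ℂ) (z : Gen → Free) (l l' : Relation) :
    Relation.eval α z (l ++ l') = Relation.eval α z l + Relation.eval α z l' := by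
  simp [Relation.eval]

lemma Relation.eval_filter (α : ℂ) (z : Gen → Free) (l : Relation) :
    Relation.eval α z (l.filter fun t => t.1 ≠ 0) = Relation.eval α z l := by
  induction l with
  | nil => rfl
  | cons t l ih =>
    rw [List.filter_cons]
    simp only [Relation.eval] at ih ⊢
    split_ifs with h
    · rw [List.map_cons, List.sum_cons, ih, List.map_cons, List.sum_cons]
    · have : t.1 = 0 := by simpa using h
      rw [ih, List.map_cons, List.sum_cons, this]
      simp

lemma Relation.eval_flatMap {ι : Type*} (α : ℂ) (z : Gen → Free) (l : List ι) (F : ι → Relation) :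
    Relation.eval α z (l.flatMap F) = (l.map fun i => Relation.eval α z (F i)).sum := by
  induction l with
  | nil => rfl
  | cons i l ih => rw [List.flatMap_cons, Relation.eval_append, ih, List.map_cons, List.sum_cons]

namespace IsFreeCocycle

variable {α : ℂ} {p : ZMod 2} {z : Gen → Free}

/-- An odd map changes parity, and parity is the weight modulo 2. -/
lemma weightProj_eq_zero_of_odd (hz : IsFreeCocycle α 1 z) (g : Gen) :
    weightProj g.weight (z g) = 0 := by
  ext m
  rw [weightProj_apply]
  split_ifs with h
  · refine hz.parity g m fun hp => ?_
    rw [← Mon.weight_cast, h, Gen.weight_cast] at hp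
    exact absurd hp (by generalize g.parity = q; revert q; decide)
  · rfl

lemma weightProj_eq_sum (hz : IsFreeCocycle α p z) (g : Gen) :
    weightProj g.weight (z g) = ((weightMons g).map fun x => Finsupp.single x (z g x)).sum := by
  have hw : ∀ x ∈ weightMons g, x.weight = g.weight := fun x hx => by
    simpa using (of_decide_eq_true (List.mem_filter.1 hx).2).1
  rw [eq_sum_single_of_nodup (nodup_weightMons g) (f := weightProj g.weight (z g))]
  · refine congrArg List.sum (List.map_congr_left fun x hx => ?_)
    rw [weightProj_apply, if_pos (hw x hx)]
  · intro x hx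
    rw [weightProj_apply] at hx
    split_ifs at hx with h
    · refine mem_weightMons ?_ h
      by_contra hd
      exact hx ((Finsupp.mem_supported' ℂ (z g)).1 (hz.mem g) x hd)
    · exact absurd rfl hx

/-- At a monomial of weight `g.weight + h.weight` only the weight-preserving part of `z h`
contributes, so the relation involves finitely many unknowns. -/
lemma eval_adRelation (hz : IsFreeCocycle α p z) (ε : ℤ) (g h : Gen) {m : Mon}
    (hm : m.weight = g.weight + h.weight) :
    Relation.eval α z (adRelation ε g h m) = ε * brFree (elt α g) (z h) m := by
  rw [brFree_elt_apply α g hm, hz.weightProj_eq_sum, adRelation, Relation.eval_flatMap]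
  generalize weightMons h = l
  induction l with
  | nil => simp
  | cons x l ih =>
    rw [List.map_cons, List.sum_cons, ih, List.map_cons, List.sum_cons, map_add, Finsupp.add_apply,
      brFree_elt_single]
    simp [Relation.eval]
    ring

lemma eval_cocycleRelation (hz : IsFreeCocycle α 0 z) (g h : Gen) {m : Mon}
    (hm : m.weight = g.weight + h.weight) :
    Relation.eval α z (cocycleRelation g h m) = 0 := by
  have hc := DFunLike.congr_fun (hz.cocycle g h) m
  rw [ksign_comm, ksign_zero_right, one_smul, Finsupp.sub_apply, Finsupp.sub_apply,
    Finsupp.smul_apply, Finsupp.finsetSum_apply, Finsupp.zero_apply, smul_eq_mul] at hc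
  rw [cocycleRelation, Relation.eval_filter, Relation.eval_append, Relation.eval_append,
    hz.eval_adRelation _ g h hm, hz.eval_adRelation _ h g (by rw [hm, add_comm]), skewSign_cast,
    Relation.eval_flatMap]
  simp only [sum_gen, Finsupp.smul_apply, smul_eq_mul] at hc
  have he : (Gen.all.map fun k => Relation.eval α z
      [(-struct₀ g h k, 0, k, m), (-struct₁ g h k, 1, k, m)]).sum =
      -(Gen.all.map fun k => struct α g h k * z k m).sum := by
    generalize Gen.all = l
    induction l with
    | nil => simp
    | cons k l ih =>
      rw [List.map_cons, List.sum_cons, ih, List.map_cons, List.sum_cons]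
      simp [Relation.eval, struct]
      ring
  rw [he]
  push_cast
  linear_combination hc

end IsFreeCocycle

/-! ### Solving the cocycle conditions -/

/-- An elimination step: if the coefficients in `S` vanish, then the cocycle condition for `s.1`
shows that the coefficient `s.2` vanishes. -/
def StepValid (S : List (Gen × Mon)) (s : (Gen × Gen × Mon) × Gen × Mon) : Prop :=
  s.1.2.2.weight = s.1.1.weight + s.1.2.1.weight ∧
  (∀ t ∈ cocycleRelation s.1.1 s.1.2.1 s.1.2.2, t.2.2 ∈ S ∨ t.2.2 = s.2 ∧ t.2.1 = 0) ∧
  ((cocycleRelation s.1.1 s.1.2.1 s.1.2.2).map fun t =>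
    if t.2.2 ∈ S then 0 else t.1).sum ≠ 0

instance (S : List (Gen × Mon)) (s : (Gen × Gen × Mon) × Gen × Mon) : Decidable (StepValid S s) := by
  unfold StepValid; infer_instance

/-- Starting from the coefficients in `S`, the steps show that all coefficients vanish. -/
def stepsValid : List (Gen × Mon) → List ((Gen × Gen × Mon) × Gen × Mon) → Bool
  | S, [] => decide (∀ g, ∀ m ∈ weightMons g, (g, m) ∈ S)
  | S, s :: l => decide (StepValid S s) && stepsValid (s.2 :: S) l

/-- Once the known unknowns are dropped, all remaining terms are `α`-free multiples of one unknown.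
Its total coefficient is therefore an integer, and if nonzero it can be cancelled for every `α`. -/
lemma Relation.eval_of_known {α : ℂ} {z : Gen → Free} {S : List (Gen × Mon)}
    (hS : ∀ q ∈ S, z q.1 q.2 = 0) {q : Gen × Mon} {l : Relation}
    (hl : ∀ t ∈ l, t.2.2 ∈ S ∨ t.2.2 = q ∧ t.2.1 = 0) :
    Relation.eval α z l = ((l.map fun t => if t.2.2 ∈ S then 0 else t.1).sum : ℤ) * z q.1 q.2 := by
  induction l with
  | nil => simp [Relation.eval]
  | cons t l ih =>
    have h1 := ih fun t ht => hl t (List.mem_cons_of_mem _ ht)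
    simp only [Relation.eval] at h1 ⊢
    rw [List.map_cons, List.sum_cons, h1, List.map_cons, List.sum_cons]
    split_ifs with h
    · rw [hS _ h, mul_zero, zero_add, zero_add]
    · obtain ⟨h2, h3⟩ := (hl t List.mem_cons_self).resolve_left h
      rw [h2, h3]
      push_cast
      ring

lemma IsFreeCocycle.eq_zero_of_stepsValid {α : ℂ} {z : Gen → Free} (hz : IsFreeCocycle α 0 z)
    (l : List ((Gen × Gen × Mon) × Gen × Mon)) :
    ∀ S : List (Gen × Mon), stepsValid S l = true → (∀ q ∈ S, z q.1 q.2 = 0) →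
      ∀ g, ∀ m ∈ weightMons g, z g m = 0 := by
  induction l with
  | nil =>
    intro S h hS g m hm
    exact hS (g, m) (of_decide_eq_true h g m hm)
  | cons s l ih =>
    intro S h hS
    rw [stepsValid, Bool.and_eq_true] at h
    obtain ⟨h1, h2, h3⟩ := of_decide_eq_true h.1
    refine ih _ h.2 fun q hq => ?_
    rcases List.mem_cons.1 hq with rfl | hq
    · have := hz.eval_cocycleRelation s.1.1 s.1.2.1 h1
      rw [Relation.eval_of_known hS h2] at this
      exact (mul_eq_zero.1 this).resolve_left (by exact_mod_cast h3)
    · exact hS q hq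

/-- The coefficients that determine a weight-preserving cocycle. -/
def initialCoeffs : List (Gen × Mon) :=
  [(.T1, 1, 0, {2}), (.T2, 1, 0, {3}), (.T3, 1, 0, {0}), (.T1, 0, -1, {1, 2, 3})]

/-- Elimination steps that derive the vanishing of all coefficients from that of the initial
ones. -/
def eliminationSteps : List ((Gen × Gen × Mon) × Gen × Mon) :=
  [((.E1, .H2, 2, 0, ∅), .H2, 1, 1, ∅),
   ((.E1, .H3, 2, 0, ∅), .H3, 1, 1, ∅),
   ((.E1, .T1, 2, -1, {2}), .E1, 1, -1, {0, 2}),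
   ((.E1, .T2, 2, -1, {3}), .E1, 1, -1, {1, 3}),
   ((.F1, .D1, -1, 2, {0}), .F1, -1, 1, {0, 2}),
   ((.F1, .D2, -1, 2, {1}), .F1, -1, 1, {1, 3}),
   ((.E2, .T1, 0, -1, {0, 1, 2}), .T4, 0, -1, {0, 1, 2}),
   ((.H2, .T2, 1, 0, {3}), .H2, 0, 0, {1, 3}),
   ((.E3, .T1, 0, -1, {0, 2, 3}), .T2, 0, -1, {0, 2, 3}),
   ((.E2, .T2, 0, -1, {0, 1, 3}), .T3, 0, -1, {0, 1, 3}),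
   ((.H3, .T1, 1, 0, {2}), .H3, 0, 0, {0, 2}),
   ((.E1, .F1, 0, 0, {0, 2}), .H1, 0, 0, {0, 2}),
   ((.H1, .E2, 0, 0, {0, 1}), .H1, 0, 0, {1, 3}),
   ((.E1, .T1, 1, -2, {1, 2, 3}), .E1, 0, -2, {0, 1, 2, 3}),
   ((.E2, .T2, 1, 0, {0}), .E2, 0, 0, {0, 1}),
   ((.E2, .T1, 1, 0, {1}), .T4, 1, 0, {1}),
   ((.F2, .T3, 1, 0, {3}), .F2, 0, 0, {2, 3}),
   ((.E3, .T1, 1, 0, {3}), .E3, 0, 0, {0, 3}),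
   ((.F3, .T2, 1, 0, {2}), .F3, 0, 0, {1, 2}),
   ((.T1, .T3, 2, 0, ∅), .E1, 2, 0, ∅),
   ((.E1, .H1, 2, 0, ∅), .H1, 1, 1, ∅),
   ((.E1, .F1, 1, 1, ∅), .F1, 0, 2, ∅),
   ((.E1, .D1, 1, 0, {0}), .D1, 0, 1, {0}),
   ((.E2, .D4, 0, 1, {0}), .D4, 0, 1, {3}),
   ((.E3, .D2, 0, 1, {0}), .D2, 0, 1, {1}),
   ((.E2, .D3, 0, 1, {1}), .D3, 0, 1, {2}),
   ((.E2, .F2, 0, 0, {1, 3}), .H3, 0, 0, {1, 3}),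
   ((.E2, .F2, 0, 0, {0, 2}), .H2, 0, 0, {0, 2}),
   ((.T1, .D1, 0, 0, {1, 3}), .D1, -1, 0, {0, 1, 3}),
   ((.E2, .D4, -1, 0, {0, 1, 3}), .D4, -1, 0, {0, 2, 3}),
   ((.E3, .D2, -1, 0, {0, 1, 3}), .D2, -1, 0, {0, 1, 2}),
   ((.E2, .D3, -1, 0, {0, 1, 2}), .D3, -1, 0, {1, 2, 3}),
   ((.F1, .T1, -1, 0, {1, 2, 3}), .F1, -2, 0, {0, 1, 2, 3})]

/-- A checked certificate that the space of weight-preserving even cocycles has dimension at most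
four. The pivots are nonzero integers, so there are no exceptional values of `α`. -/
lemma stepsValid_eliminationSteps : stepsValid initialCoeffs eliminationSteps = true := by
  decide +kernel

/-! ### Super skew-symmetry, torus coboundaries and `θ` as cocycles -/

lemma brLists_skew : ∀ g h : Gen,
    TermsEq (brLists (thetaTerms g) (genTerms₀ h))
      (smulTerms (skewSign g h) (brLists (genTerms₀ h) (thetaTerms g))) ∧
    TermsEq (brLists (thetaTerms g) (genTerms₁ h))
      (smulTerms (skewSign g h) (brLists (genTerms₁ h) (thetaTerms g))) := by
  decide +kernel

lemma brFree_thetaElt_elt (α : ℂ) (g h : Gen) :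
    brFree (thetaElt g) (elt α h) =
      -ksign h.parity (0 + g.parity) • brFree (elt α h) (thetaElt g) := by
  obtain ⟨h0, h1⟩ := brLists_skew g h
  have h0 := sumTerms_eq_sumTerms h0
  have h1 := sumTerms_eq_sumTerms h1
  simp only [sumTerms_smulTerms, sumTerms_brLists, skewSign_cast] at h0 h1
  rw [elt, thetaElt, map_add, map_smul, h0, h1, map_add, map_smul, LinearMap.add_apply,
    LinearMap.smul_apply]
  module

lemma struct_skew : ∀ g h k : Gen, struct₀ g h k = skewSign g h * struct₀ h g k ∧
    struct₁ g h k = skewSign g h * struct₁ h g k := by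
  decide +kernel

lemma brFree_elt_skew (α : ℂ) (g h : Gen) :
    brFree (elt α g) (elt α h) =
      -ksign h.parity (0 + g.parity) • brFree (elt α h) (elt α g) := by
  rw [brFree_elt, brFree_elt, Finset.smul_sum]
  refine Finset.sum_congr rfl fun k _ => ?_
  rw [smul_smul, ← skewSign_cast, struct, struct, (struct_skew g h k).1, (struct_skew g h k).2]
  push_cast
  congr 1
  ring

/-- The labels of the basis of the torus. -/
def torusGens : List Gen := [.H1, .H2, .H3]

lemma struct_torusGens : ∀ t ∈ torusGens, ∀ g k : Gen,
    struct₀ g t k = (if k = g then -struct₀ t g g else 0) ∧ struct₁ g t k = 0 := by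
  decide +kernel

lemma brFree_elt_torus (α : ℂ) {t : Gen} (ht : t ∈ torusGens) (g : Gen) :
    brFree (elt α g) (elt α t) = -(struct₀ t g g : ℂ) • elt α g := by
  rw [brFree_elt, Finset.sum_eq_single g]
  · rw [struct, (struct_torusGens t ht g g).1, (struct_torusGens t ht g g).2]
    simp
  · intro k _ hk
    rw [struct, (struct_torusGens t ht g k).1, (struct_torusGens t ht g k).2, if_neg hk]
    simp
  · simp

/-- The torus acts by derivations: wherever a structure constant is nonzero, torus eigenvalues add.
This is what makes a torus coboundary a cocycle. -/
lemma struct_weight : ∀ g h k : Gen, (struct₀ g h k = 0 ∧ struct₁ g h k = 0) ∨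
    ∀ t ∈ torusGens, struct₀ t k k = struct₀ t g g + struct₀ t h h := by
  decide +kernel

lemma weightProj_eq_self {f : Free} {w : ℤ} (hf : ∀ x, f x ≠ 0 → x.weight = w) :
    weightProj w f = f := by
  ext x
  rw [weightProj_apply]
  split_ifs with h
  · rfl
  · by_contra h0
    exact h (hf x (Ne.symm h0))

lemma elt_apply (α : ℂ) (g : Gen) (x : Mon) :
    elt α g x = termCoeff (genTerms₀ g) x + α * termCoeff (genTerms₁ g) x := by
  rw [elt, Finsupp.add_apply, Finsupp.smul_apply, sumTerms_apply, sumTerms_apply, smul_eq_mul]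

namespace IsFreeCocycle

variable {α : ℂ} {p : ZMod 2} {z z' : Gen → Free}

lemma add (hz : IsFreeCocycle α p z) (hz' : IsFreeCocycle α p z') :
    IsFreeCocycle α p fun g => z g + z' g where
  mem g := Submodule.add_mem _ (hz.mem g) (hz'.mem g)
  parity g x hx := by rw [Finsupp.add_apply, hz.parity g x hx, hz'.parity g x hx, add_zero]
  cocycle g h := by
    have h1 := hz.cocycle g h
    have h2 := hz'.cocycle g h
    simp only [map_add, smul_add, Finset.sum_add_distrib]
    linear_combination (norm := module) h1 + h2

lemma smul (a : ℂ) (hz : IsFreeCocycle α p z) : IsFreeCocycle α p fun g => a • z g where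
  mem g := Submodule.smul_mem _ _ (hz.mem g)
  parity g x hx := by rw [Finsupp.smul_apply, hz.parity g x hx, smul_zero]
  cocycle g h := by
    have h1 := hz.cocycle g h
    simp only [map_smul, smul_comm _ a, ← Finset.smul_sum]
    linear_combination (norm := module) a • h1

/-- The map `θ` is a cocycle. -/
lemma of_thetaElt (α : ℂ) : IsFreeCocycle α 0 thetaElt where
  mem g := (Finsupp.mem_supported' ℂ _).2 fun x hx => by
    by_contra h
    exact hx (thetaElt_apply_ne_zero h).2.1
  parity g x hx := by
    by_contra h
    exact hx (by rw [(thetaElt_apply_ne_zero h).2.2, zero_add])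
  cocycle g h := by
    rw [← brFree_elt_thetaElt, brFree_thetaElt_elt, ksign_comm, ksign_zero_right]
    module

/-- The coboundary of an element of the torus is a cocycle. -/
lemma torusCoboundary (α : ℂ) {t : Gen} (ht : t ∈ torusGens) :
    IsFreeCocycle α 0 fun g => brFree (elt α g) (elt α t) where
  mem g := by
    rw [brFree_elt_torus α ht]
    refine Submodule.smul_mem _ _ ((Finsupp.mem_supported' ℂ _).2 fun x hx => ?_)
    by_contra h
    exact hx (elt_apply_ne_zero h).2.1
  parity g x hx := by
    rw [brFree_elt_torus α ht, Finsupp.smul_apply]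
    by_contra h
    exact hx (by rw [(elt_apply_ne_zero (right_ne_zero_of_smul h)).2.2, zero_add])
  cocycle g h := by
    have hs : ∑ k, struct α g h k • brFree (elt α k) (elt α t) =
        -((struct₀ t g g : ℂ) + struct₀ t h h) • brFree (elt α g) (elt α h) := by
      rw [brFree_elt α g h, Finset.smul_sum]
      refine Finset.sum_congr rfl fun k _ => ?_
      rw [brFree_elt_torus α ht]
      rcases struct_weight g h k with h0 | h0
      · simp [struct, h0]
      · rw [h0 t ht]
        push_cast
        module
    rw [hs, brFree_elt_torus α ht, brFree_elt_torus α ht, map_smul, map_smul, ksign_comm,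
      ksign_zero_right]
    linear_combination (norm := module) (struct₀ t g g : ℂ) • brFree_elt_skew α g h

/-- The weight-preserving part of an even cocycle is cohomologous to a multiple of `θ`. -/
lemma exists_weightProj_eq (hz : IsFreeCocycle α 0 z) : ∃ a b d c : ℂ, ∀ g,
    weightProj g.weight (z g) =
      brFree (elt α g) (a • elt α .H1 + b • elt α .H2 + d • elt α .H3) + c • thetaElt g := by
  set p₁ := z .T1 (1, 0, {2})
  set p₂ := z .T2 (1, 0, {3})
  set p₃ := z .T3 (1, 0, {0})
  set c := z .T1 (0, -1, {1, 2, 3})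
  -- The coboundary of `a tτ + b ξ₁η₁ + d ξ₂η₂` multiplies `T1`, `T2`, `T3` by `b - a`, `d - a` and
  -- `-a - b`. The constants solve the equations that make these factors `p₁`, `p₂`, `p₃`; the
  -- fourth coefficient is seen by `θ` alone.
  set a : ℂ := -(p₁ + p₃) / 2
  set b : ℂ := (p₁ - p₃) / 2
  set d : ℂ := p₂ + a
  refine ⟨a, b, d, c, ?_⟩
  have h1 : Gen.H1 ∈ torusGens := by decide
  have h2 : Gen.H2 ∈ torusGens := by decide
  have h3 : Gen.H3 ∈ torusGens := by decide
  set y : Gen → Free := fun g =>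
    brFree (elt α g) (a • elt α .H1 + b • elt α .H2 + d • elt α .H3) + c • thetaElt g with hy
  have hy' : y = fun g => (a • brFree (elt α g) (elt α .H1) + b • brFree (elt α g) (elt α .H2) +
      d • brFree (elt α g) (elt α .H3)) + c • thetaElt g := by
    funext g
    simp only [hy, map_add, map_smul]
  have hyc : IsFreeCocycle α 0 y := by
    rw [hy']
    exact ((((torusCoboundary α h1).smul a).add ((torusCoboundary α h2).smul b)).add
      ((torusCoboundary α h3).smul d)).add ((of_thetaElt α).smul c)
  have hy'' : ∀ g, y g = -(a * struct₀ .H1 g g + b * struct₀ .H2 g g + d * struct₀ .H3 g g) •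
      elt α g + c • thetaElt g := by
    intro g
    rw [hy']
    simp only [brFree_elt_torus α h1, brFree_elt_torus α h2, brFree_elt_torus α h3]
    module
  have hyw : ∀ g, weightProj g.weight (y g) = y g := fun g => by
    refine weightProj_eq_self fun x hx => ?_
    rw [hy''] at hx
    by_cases he : elt α g x = 0
    · refine (thetaElt_apply_ne_zero (g := g) fun ht => hx ?_).1
      simp [he, ht]
    · exact (elt_apply_ne_zero he).1
  -- The difference is a cocycle whose four initial coefficients vanish, so elimination applies to
  -- it.
  have hu : IsFreeCocycle α 0 fun g => z g + (-1 : ℂ) • y g := hz.add (hyc.smul (-1))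
  have hv := hu.eq_zero_of_stepsValid eliminationSteps initialCoeffs stepsValid_eliminationSteps (by
    have key : ∀ q ∈ initialCoeffs, z q.1 q.2 = y q.1 q.2 := by
      intro q hq
      rw [hy'', Finsupp.add_apply, Finsupp.smul_apply, Finsupp.smul_apply, elt_apply, thetaElt,
        sumTerms_apply]
      simp only [initialCoeffs, List.mem_cons, List.not_mem_nil, or_false] at hq
      rcases hq with rfl | rfl | rfl | rfl
      · obtain ⟨e1, e2, e3, e4, e5, e6⟩ : struct₀ .H1 .T1 .T1 = 1 ∧
            struct₀ .H2 .T1 .T1 = -1 ∧ struct₀ .H3 .T1 .T1 = 0 ∧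
            termCoeff (genTerms₀ .T1) (1, 0, {2}) = 1 ∧ termCoeff (genTerms₁ .T1) (1, 0, {2}) = 0 ∧
            termCoeff (thetaTerms .T1) (1, 0, {2}) = 0 := by decide +kernel
        rw [e1, e2, e3, e4, e5, e6]
        change p₁ = _
        push_cast
        simp only [smul_eq_mul, a, b, d]
        ring
      · obtain ⟨e1, e2, e3, e4, e5, e6⟩ : struct₀ .H1 .T2 .T2 = 1 ∧
            struct₀ .H2 .T2 .T2 = 0 ∧ struct₀ .H3 .T2 .T2 = -1 ∧
            termCoeff (genTerms₀ .T2) (1, 0, {3}) = 1 ∧ termCoeff (genTerms₁ .T2) (1, 0, {3}) = 0 ∧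
            termCoeff (thetaTerms .T2) (1, 0, {3}) = 0 := by decide +kernel
        rw [e1, e2, e3, e4, e5, e6]
        change p₂ = _
        push_cast
        simp only [smul_eq_mul, a, b, d]
        ring
      · obtain ⟨e1, e2, e3, e4, e5, e6⟩ : struct₀ .H1 .T3 .T3 = 1 ∧
            struct₀ .H2 .T3 .T3 = 1 ∧ struct₀ .H3 .T3 .T3 = 0 ∧
            termCoeff (genTerms₀ .T3) (1, 0, {0}) = 1 ∧ termCoeff (genTerms₁ .T3) (1, 0, {0}) = 0 ∧
            termCoeff (thetaTerms .T3) (1, 0, {0}) = 0 := by decide +kernel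
        rw [e1, e2, e3, e4, e5, e6]
        change p₃ = _
        push_cast
        simp only [smul_eq_mul, a, b, d]
        ring
      · obtain ⟨e1, e2, e3, e4, e5, e6⟩ : struct₀ .H1 .T1 .T1 = 1 ∧
            struct₀ .H2 .T1 .T1 = -1 ∧ struct₀ .H3 .T1 .T1 = 0 ∧
            termCoeff (genTerms₀ .T1) (0, -1, {1, 2, 3}) = 0 ∧
            termCoeff (genTerms₁ .T1) (0, -1, {1, 2, 3}) = 0 ∧
            termCoeff (thetaTerms .T1) (0, -1, {1, 2, 3}) = 1 := by decide +kernel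
        rw [e1, e2, e3, e4, e5, e6]
        change c = _
        push_cast
        simp only [smul_eq_mul, a, b, d]
        ring
    intro q hq
    rw [Finsupp.add_apply, Finsupp.smul_apply, key q hq, smul_eq_mul]
    ring)
  intro g
  have h0 := hu.weightProj_eq_sum g
  rw [List.sum_eq_zero, map_add, map_smul, hyw] at h0
  · linear_combination (norm := module) h0
  · intro f hf
    obtain ⟨x, hx, rfl⟩ := List.mem_map.1 hf
    rw [hv g x hx, Finsupp.single_zero]

end IsFreeCocycle

/-! ### Cocycles, coboundaries and deformations -/

lemma IsFreeCocycle.exists_eq {α : ℂ} {p : ZMod 2} {z : Gen → Free} (hz : IsFreeCocycle α p z) :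
    ∃ n ∈ Finsupp.supported ℂ ℂ derivedMons, (∀ x : Mon, x.parity ≠ p → n x = 0) ∧ ∃ c : ℂ,
      ∀ g, z g = ksign p g.parity • brFree (elt α g) n + c • thetaElt g := by
  obtain ⟨n, hn, hnp, h⟩ := hz.exists_eq_add_weightProj
  have hp : ∀ p : ZMod 2, p = 0 ∨ p = 1 := by decide
  rcases hp p with rfl | rfl
  · obtain ⟨a, b, d, c, hw⟩ := hz.exists_weightProj_eq
    have hmem : ∀ g, elt α g ∈ Finsupp.supported ℂ ℂ derivedMons := fun g =>
      (Finsupp.mem_supported' ℂ _).2 fun x hx => by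
        by_contra h
        exact hx (elt_apply_ne_zero h).2.1
    have hpar : ∀ g : Gen, g.parity = 0 → ∀ x : Mon, x.parity ≠ 0 → elt α g x = 0 :=
      fun g hg x hx => by
        by_contra h
        exact hx ((elt_apply_ne_zero h).2.2.trans hg)
    -- The torus coboundaries have primitives in `Γ_α`, hence in `K'(4)`, which are absorbed into
    -- `n`.
    refine ⟨n + (a • elt α .H1 + b • elt α .H2 + d • elt α .H3), ?_, fun x hx => ?_, c, fun g => ?_⟩
    · exact Submodule.add_mem _ hn (Submodule.add_mem _ (Submodule.add_mem _
        (Submodule.smul_mem _ _ (hmem _)) (Submodule.smul_mem _ _ (hmem _)))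
        (Submodule.smul_mem _ _ (hmem _)))
    · simp [hnp x hx, hpar .H1 rfl x hx, hpar .H2 rfl x hx, hpar .H3 rfl x hx]
    · rw [h g, hw g, ksign_comm, ksign_zero_right, map_add (brFree (elt α g)) n]
      module
  · refine ⟨n, hn, hnp, 0, fun g => ?_⟩
    rw [h g, hz.weightProj_eq_zero_of_odd, zero_smul]

/-! ### From the basis to homogeneous elements and bilinear identities -/

lemma gammaBasis_eq (g : Gen) : gammaBasis g = coord.symm (Pi.single g 1) := by
  rw [← coord_gammaBasis, LinearEquiv.symm_apply_apply]

lemma mem_gammaAlpha_part_zero (α : ℂ) (X : GammaSpace) :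
    X ∈ (gammaAlpha α).part 0 ↔ X.2 = 0 := Iff.rfl

lemma mem_gammaAlpha_part_one (α : ℂ) (X : GammaSpace) :
    X ∈ (gammaAlpha α).part 1 ↔ X.1 = 0 := Iff.rfl

lemma mkSp_zero : mkSp 0 0 0 = 0 := by
  refine Subtype.ext ?_
  ext i j
  fin_cases i <;> fin_cases j <;> simp [mkSp]

lemma gammaBasis_mem_part (α : ℂ) (g : Gen) : gammaBasis g ∈ (gammaAlpha α).part g.parity := by
  rw [gammaBasis_eq]
  cases g <;> simp only [Gen.parity, mem_gammaAlpha_part_zero, mem_gammaAlpha_part_one]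
  all_goals
    first
    | (ext i j k; fin_cases i <;> fin_cases j <;> fin_cases k <;> simp [coord])
    | simp [coord, mkSp_zero]

lemma coord_eq_zero_of_mem_part {α : ℂ} {q : ZMod 2} {X : GammaSpace}
    (hX : X ∈ (gammaAlpha α).part q) {g : Gen} (hg : g.parity ≠ q) : coord X g = 0 := by
  have hq : ∀ q : ZMod 2, q = 0 ∨ q = 1 := by decide
  rcases hq q with rfl | rfl
  · rw [mem_gammaAlpha_part_zero] at hX
    cases g <;> simp_all [Gen.parity, coord_apply, coordFun]
  · rw [mem_gammaAlpha_part_one] at hX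
    cases g <;> simp_all [Gen.parity, coord_apply, coordFun]

lemma gammaAlpha_part_eq_span (α : ℂ) (q : ZMod 2) :
    (gammaAlpha α).part q = Submodule.span ℂ (gammaBasis '' {g | g.parity = q}) := by
  refine le_antisymm (fun X hX => ?_) (Submodule.span_le.2 ?_)
  · rw [← sum_coord_smul X]
    refine Submodule.sum_mem _ fun g _ => ?_
    by_cases hg : g.parity = q
    · exact Submodule.smul_mem _ _ (Submodule.subset_span ⟨g, hg, rfl⟩)
    · rw [coord_eq_zero_of_mem_part hX hg, zero_smul]
      exact Submodule.zero_mem _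
  · rintro _ ⟨g, hg, rfl⟩
    have := gammaBasis_mem_part α g
    rwa [show g.parity = q from hg] at this

/-- Two linear maps agree on a homogeneous component if they agree on its basis. -/
lemma eqOn_part {W : Type*} [AddCommGroup W] [Module ℂ W] {α : ℂ} {q : ZMod 2}
    {φ φ' : GammaSpace →ₗ[ℂ] W} (h : ∀ g : Gen, g.parity = q → φ (gammaBasis g) = φ' (gammaBasis g))
    {X : GammaSpace} (hX : X ∈ (gammaAlpha α).part q) : φ X = φ' X := by
  rw [gammaAlpha_part_eq_span] at hX
  refine LinearMap.eqOn_span ?_ hX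
  rintro _ ⟨g, hg, rfl⟩
  exact h g hg

lemma hasParity_of_gammaBasis {α : ℂ} {p : ZMod 2} {φ : GammaSpace →ₗ[ℂ] P4}
    (h : ∀ g : Gen, φ (gammaBasis g) ∈ poisson.part (p + g.parity)) :
    HasParity (gammaAlpha α) poisson p φ := by
  intro q X hX
  rw [gammaAlpha_part_eq_span] at hX
  have hle : Submodule.span ℂ (gammaBasis '' {g | g.parity = q}) ≤
      (poisson.part (p + q)).comap φ := Submodule.span_le.2 (by
    rintro _ ⟨g, hg, rfl⟩
    have := h g
    rwa [show g.parity = q from hg] at this)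
  exact hle hX

lemma mem_of_gammaBasis {φ : GammaSpace →ₗ[ℂ] P4} {N : Submodule ℂ P4}
    (h : ∀ g : Gen, φ (gammaBasis g) ∈ N) (X : GammaSpace) : φ X ∈ N := by
  rw [← sum_coord_smul X, map_sum]
  refine Submodule.sum_mem _ fun g _ => ?_
  rw [map_smul]
  exact Submodule.smul_mem _ _ (h g)

lemma hasParity_rho (α : ℂ) : HasParity (gammaAlpha α) poisson 0 (rho α) :=
  hasParity_of_gammaBasis fun g => by
    rw [rho_gammaBasis, ofFree_mem_part_iff]
    intro x hx
    by_contra h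
    exact hx (by rw [(elt_apply_ne_zero h).2.2, zero_add])

lemma hasParity_theta (α : ℂ) : HasParity (gammaAlpha α) poisson 0 theta :=
  hasParity_of_gammaBasis fun g => by
    rw [theta_gammaBasis, ofFree_mem_part_iff]
    exact (IsFreeCocycle.of_thetaElt α).parity g

lemma rho_mem (α : ℂ) (X : GammaSpace) : rho α X ∈ K4' := by
  refine mem_of_gammaBasis (fun g => ?_) X
  rw [rho_gammaBasis, K4'_eq]
  refine Submodule.mem_map_of_mem ((Finsupp.mem_supported' ℂ _).2 fun x hx => ?_)
  by_contra h
  exact hx (elt_apply_ne_zero h).2.1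

lemma theta_mem (X : GammaSpace) : theta X ∈ K4' := by
  refine mem_of_gammaBasis (fun g => ?_) X
  rw [theta_gammaBasis, K4'_eq]
  exact Submodule.mem_map_of_mem ((IsFreeCocycle.of_thetaElt 0).mem g)

/-- Two bilinear maps agree if they agree on the basis. -/
lemma bilin_ext {W : Type*} [AddCommGroup W] [Module ℂ W]
    {φ φ' : GammaSpace →ₗ[ℂ] GammaSpace →ₗ[ℂ] W}
    (h : ∀ g h : Gen, φ (gammaBasis g) (gammaBasis h) = φ' (gammaBasis g) (gammaBasis h)) : φ = φ' :=
  LinearMap.ext_basis gammaBasis gammaBasis h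

lemma rho_br (α : ℂ) (X Y : GammaSpace) :
    rho α ((gammaAlpha α).br X Y) = poisson.br (rho α X) (rho α Y) := by
  refine LinearMap.congr_fun₂ (bilin_ext (φ := (gammaAlpha α).br.compr₂ (rho α))
    (φ' := poisson.br.compl₁₂ (rho α) (rho α)) fun g h => ?_) X Y
  rw [LinearMap.compr₂_apply, LinearMap.compl₁₂_apply, br_gammaBasis, map_sum, rho_gammaBasis,
    rho_gammaBasis, ← ofFree_brFree, brFree_elt, map_sum]
  simp only [map_smul, rho_gammaBasis]

lemma theta_br (α : ℂ) (X Y : GammaSpace) : theta ((gammaAlpha α).br X Y) =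
    poisson.br (rho α X) (theta Y) + poisson.br (theta X) (rho α Y) := by
  refine LinearMap.congr_fun₂ (bilin_ext (φ := (gammaAlpha α).br.compr₂ theta)
    (φ' := poisson.br.compl₁₂ (rho α) theta + poisson.br.compl₁₂ theta (rho α)) fun g h => ?_) X Y
  rw [LinearMap.compr₂_apply, LinearMap.add_apply, LinearMap.add_apply, LinearMap.compl₁₂_apply,
    LinearMap.compl₁₂_apply, br_gammaBasis, map_sum, rho_gammaBasis, rho_gammaBasis,
    theta_gammaBasis, theta_gammaBasis, ← ofFree_brFree, ← ofFree_brFree, ← map_add,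
    brFree_elt_thetaElt, map_sum]
  simp only [map_smul, theta_gammaBasis]

lemma br_theta_theta (X Y : GammaSpace) : poisson.br (theta X) (theta Y) = 0 := by
  refine LinearMap.congr_fun₂ (bilin_ext (φ := poisson.br.compl₁₂ theta theta) (φ' := 0)
    fun g h => ?_) X Y
  rw [LinearMap.compl₁₂_apply, theta_gammaBasis, theta_gammaBasis, ← ofFree_brFree,
    brFree_thetaElt]
  simp

lemma theta_eq_br_c3 (α : ℂ) (X : GammaSpace) : theta X = poisson.br (rho α X) c3 := by
  have hc : c3 = ofFree (Finsupp.single topMon 1) := by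
    rw [ofFree_single, one_smul]; rfl
  refine LinearMap.congr_fun (gammaBasis.ext (f₁ := theta)
    (f₂ := (poisson.br.flip c3).comp (rho α)) fun g => ?_) X
  rw [LinearMap.comp_apply, LinearMap.flip_apply, theta_gammaBasis, rho_gammaBasis, hc,
    ← ofFree_brFree, ← thetaElt_eq]

/-- The leading monomials of the basis of `Γ_α`. -/
def leadMon (g : Gen) : Mon := (genTerms₀ g).headI.2

lemma termCoeff_leadMon : ∀ g h : Gen,
    termCoeff (genTerms₀ g) (leadMon h) = (if g = h then 1 else 0) ∧
    termCoeff (genTerms₁ g) (leadMon h) = 0 := by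
  decide +kernel

/-- The leading monomial of each basis element occurs in no other basis element, nor in any
`α`-correction, so its coefficient reads off the corresponding coordinate. -/
lemma rho_injective (α : ℂ) : Function.Injective (rho α) := by
  rw [injective_iff_map_eq_zero]
  intro X hX
  refine coord.map_eq_zero_iff.1 (funext fun h => ?_)
  have := congrArg (monCoeff (leadMon h)) hX
  simp only [rho_eq_sum, map_sum, map_smul, monCoeff_ofFree, elt_apply,
    termCoeff_leadMon, map_zero] at this
  rw [Finset.sum_eq_single h] at this
  · simpa using this
  · intro g _ hg
    simp [hg]
  · simp

lemma theta_mem_cocycles (α : ℂ) :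
    theta ∈ cocyclesOfParity (gammaAlpha α) poisson (rho α) K4' 0 := by
  refine ⟨theta_mem, hasParity_theta α, fun q r X hX Y hY => ?_⟩
  -- The derivation property becomes the cocycle condition after one bracket is reversed.
  -- Skew-symmetry is known on basis elements and is extended by linearity, one homogeneous argument
  -- at a time.
  have hskew_basis : ∀ h : Gen, h.parity = r → poisson.br (theta X) (rho α (gammaBasis h)) =
      -ksign r (0 + q) • poisson.br (rho α (gammaBasis h)) (theta X) := fun h hh => by
    have := eqOn_part (φ := (poisson.br.flip (rho α (gammaBasis h))).comp theta)
      (φ' := -ksign r (0 + q) • (poisson.br (rho α (gammaBasis h))).comp theta) (fun g hg => by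
        simp only [LinearMap.comp_apply, LinearMap.flip_apply, LinearMap.smul_apply,
          rho_gammaBasis, theta_gammaBasis, ← ofFree_brFree, brFree_thetaElt_elt, map_smul, hh,
          hg]) hX
    simpa only [LinearMap.comp_apply, LinearMap.flip_apply, LinearMap.smul_apply] using this
  have hskew : poisson.br (theta X) (rho α Y) =
      -ksign r (0 + q) • poisson.br (rho α Y) (theta X) := by
    have := eqOn_part (φ := (poisson.br (theta X)).comp (rho α))
      (φ' := -ksign r (0 + q) • (poisson.br.flip (theta X)).comp (rho α)) (fun h hh => by
        simpa only [LinearMap.comp_apply, LinearMap.flip_apply, LinearMap.smul_apply] using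
          hskew_basis h hh) hY
    simpa only [LinearMap.comp_apply, LinearMap.flip_apply, LinearMap.smul_apply] using this
  rw [theta_br, hskew, ksign_comm, ksign_zero_right]
  module

/-! ### The cohomology class of `θ` -/

lemma elt_E1 (α : ℂ) : elt α .E1 = Finsupp.single (2, 0, ∅) 1 := by
  simp [elt, genTerms₀, genTerms₁, sumTerms]

/-- Bracketing with `t²` differentiates by `τ`, so this coefficient detects exactly the component
along `c₃`. -/
lemma brFree_E1_apply (α : ℂ) (f : Free) :
    brFree (elt α .E1) f (0, -2, {0, 1, 2, 3}) = 2 * f topMon := by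
  rw [elt_E1]
  induction f using Finsupp.induction_linear with
  | zero => simp
  | add f f' hf hf' => rw [map_add, Finsupp.add_apply, hf, hf', Finsupp.add_apply]; ring
  | single y b =>
    obtain ⟨c, d, J⟩ := y
    rw [brFree_single, Finsupp.smul_apply, sumTerms_brTerms_apply, Finsupp.single_apply]
    simp only [prodSign_empty, (oddTerms_torus _ _).1, Finset.empty_union, Prod.mk.injEq, topMon,
      Int.cast_zero, ite_self, add_zero]
    by_cases h : c = -1 ∧ d = -1 ∧ J = {0, 1, 2, 3}
    · obtain ⟨rfl, rfl, rfl⟩ := h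
      norm_num
      ring
    · rw [if_neg h, if_neg (fun h' => h ⟨by omega, by omega, h'.2.2⟩)]
      simp

/-- A linear functional that vanishes on coboundaries because `K'(4)` has no component along `c₃`;
it separates `θ` from them. -/
lemma monCoeff_eq_zero_of_mem_B1 {α : ℂ} {c : GammaSpace →ₗ[ℂ] P4}
    (hc : c ∈ B1 (gammaAlpha α) poisson (rho α) K4') :
    monCoeff (0, -2, {0, 1, 2, 3}) (c (gammaBasis .E1)) = 0 := by
  induction hc using Submodule.span_induction with
  | mem c hc =>
    obtain ⟨p, n, hn, -, h⟩ := hc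
    rw [K4'_eq] at hn
    obtain ⟨f, hf, rfl⟩ := hn
    rw [h _ _ (gammaBasis_mem_part α .E1), rho_gammaBasis, ← ofFree_brFree, map_smul,
      monCoeff_ofFree, brFree_E1_apply,
      (Finsupp.mem_supported' ℂ f).1 hf topMon (fun h => h.2 rfl)]
    simp
  | zero => simp
  | add c c' _ _ h h' => rw [LinearMap.add_apply, map_add, h, h', add_zero]
  | smul a c _ h => rw [LinearMap.smul_apply, map_smul, h, smul_zero]

lemma theta_notMem_B1 (α : ℂ) : theta ∉ B1 (gammaAlpha α) poisson (rho α) K4' := fun h => by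
  have := monCoeff_eq_zero_of_mem_B1 h
  rw [theta_gammaBasis, monCoeff_ofFree, thetaElt_eq α, brFree_E1_apply] at this
  simp at this

lemma exists_sub_smul_theta_mem_B1 {α : ℂ} {p : ZMod 2} {c : GammaSpace →ₗ[ℂ] P4}
    (hc : c ∈ cocyclesOfParity (gammaAlpha α) poisson (rho α) K4' p) :
    ∃ a : ℂ, c - a • theta ∈ B1 (gammaAlpha α) poisson (rho α) K4' := by
  obtain ⟨hN, hp, hcoc⟩ := hc
  have hlift : ∀ g, ∃ f ∈ Finsupp.supported ℂ ℂ derivedMons, ofFree f = c (gammaBasis g) := by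
    intro g
    have := hN (gammaBasis g)
    rwa [K4'_eq] at this
  choose z hz hzc using hlift
  have hzc' : IsFreeCocycle α p z :=
    { mem := hz
      parity := fun g => by
        have := hp _ _ (gammaBasis_mem_part α g)
        rwa [← hzc, ofFree_mem_part_iff] at this
      cocycle := fun g h => by
        refine ofFree_injective ?_
        have := hcoc _ _ _ (gammaBasis_mem_part α g) _ (gammaBasis_mem_part α h)
        rw [br_gammaBasis, map_sum] at this
        simp only [map_smul, rho_gammaBasis, ← hzc, ← ofFree_brFree] at this
        simp only [map_sub, map_smul, map_sum, map_zero]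
        exact this }
  obtain ⟨n, hn, hnp, a, h⟩ := hzc'.exists_eq
  refine ⟨a, Submodule.subset_span ⟨p, ofFree n, ?_, (ofFree_mem_part_iff p n).2 hnp, ?_⟩⟩
  · rw [K4'_eq]
    exact Submodule.mem_map_of_mem hn
  · intro q X hX
    refine eqOn_part (φ := c - a • theta)
      (φ' := ksign p q • (poisson.br.flip (ofFree n)).comp (rho α)) (fun g hg => ?_) hX
    rw [LinearMap.sub_apply, LinearMap.smul_apply, LinearMap.smul_apply, LinearMap.comp_apply,
      LinearMap.flip_apply, ← hzc, h g, theta_gammaBasis, rho_gammaBasis, ← ofFree_brFree, hg,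
      map_add, map_smul, map_smul]
    module

lemma exists_sub_smul_theta_mem_B1_of_mem_Z1 {α : ℂ} {c : GammaSpace →ₗ[ℂ] P4}
    (hc : c ∈ Z1 (gammaAlpha α) poisson (rho α) K4') :
    ∃ a : ℂ, c - a • theta ∈ B1 (gammaAlpha α) poisson (rho α) K4' := by
  obtain ⟨c₀, h₀, c₁, h₁, rfl⟩ := Submodule.mem_sup.1 hc
  obtain ⟨a₀, ha₀⟩ := exists_sub_smul_theta_mem_B1 h₀
  obtain ⟨a₁, ha₁⟩ := exists_sub_smul_theta_mem_B1 h₁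
  refine ⟨a₀ + a₁, ?_⟩
  convert Submodule.add_mem _ ha₀ ha₁ using 1
  module

lemma theta_mem_Z1 (α : ℂ) : theta ∈ Z1 (gammaAlpha α) poisson (rho α) K4' :=
  Submodule.mem_sup_left (theta_mem_cocycles α)

/-- The cohomology class of `θ`. -/
noncomputable def thetaClass (α : ℂ) : H1 (gammaAlpha α) poisson (rho α) K4' :=
  Submodule.Quotient.mk ⟨theta, theta_mem_Z1 α⟩

lemma thetaClass_ne_zero (α : ℂ) : thetaClass α ≠ 0 := fun h => by
  rw [thetaClass, Submodule.Quotient.mk_eq_zero] at h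
  exact theta_notMem_B1 α h

lemma exists_smul_thetaClass_eq (α : ℂ) (v : H1 (gammaAlpha α) poisson (rho α) K4') :
    ∃ a : ℂ, a • thetaClass α = v := by
  obtain ⟨⟨c, hc⟩, rfl⟩ := Submodule.Quotient.mk_surjective _ v
  obtain ⟨a, ha⟩ := exists_sub_smul_theta_mem_B1_of_mem_Z1 hc
  refine ⟨a, ?_⟩
  rw [thetaClass, ← Submodule.Quotient.mk_smul, eq_comm, Submodule.Quotient.eq]
  exact ha

/-! ### The deformation -/

lemma isSuperHom_rho_add_smul_theta (α β : ℂ) :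
    IsSuperHom (gammaAlpha α) poisson (rho α + β • theta) := by
  refine ⟨fun q X hX => ?_, fun X Y => ?_⟩
  · exact Submodule.add_mem _ (hasParity_rho α q X hX)
      (Submodule.smul_mem _ _ (hasParity_theta α q X hX))
  · simp only [LinearMap.add_apply, LinearMap.smul_apply, map_add, map_smul, rho_br, theta_br,
      br_theta_theta]
    module

lemma isFormalDeformation_rho_theta (α : ℂ) :
    IsFormalDeformation (gammaAlpha α) poisson K4' (rho α)
      (fun k => if k = 0 then rho α else if k = 1 then theta else 0) := by
  refine ⟨if_pos rfl, fun k => ?_, fun k X => ?_, fun n X Y => ?_⟩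
  · dsimp only
    split_ifs
    · exact hasParity_rho α
    · exact hasParity_theta α
    · exact fun q X _ => Submodule.zero_mem _
  · dsimp only
    split_ifs
    · exact rho_mem α X
    · exact theta_mem X
    · exact Submodule.zero_mem _
  · match n with
    | 0 => simp [rho_br]
    | 1 => simp [Finset.Nat.antidiagonal_succ, theta_br]
    | n + 2 =>
      simp only [Nat.add_eq_zero_iff, OfNat.ofNat_ne_zero, and_false, if_false,
        show n + 2 ≠ 1 by omega, LinearMap.zero_apply]
      refine (Finset.sum_eq_zero fun ij hij => ?_).symm
      rw [Finset.HasAntidiagonal.mem_antidiagonal] at hij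
      obtain ⟨i, j⟩ := ij
      dsimp only at hij ⊢
      -- In order at least two every pair with an index above 1 has a zero factor. The only
      -- remaining pair is `(1, 1)`, which gives `[θ, θ] = 0`.
      by_cases hi : i ≤ 1
      · by_cases hj : j ≤ 1
        · obtain rfl : i = 1 := by omega
          obtain rfl : j = 1 := by omega
          simp [br_theta_theta]
        · simp [show j ≠ 0 by omega, show j ≠ 1 by omega]
      · simp [show i ≠ 0 by omega, show i ≠ 1 by omega]

end D21

theorem corollary4p2 (α : ℂ) :
    -- `ρ_α` is an embedding of Lie superalgebras with values in `K'(4)`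
    (D21.IsSuperHom (D21.gammaAlpha α) D21.poisson (D21.rho α) ∧
      Function.Injective (D21.rho α) ∧ ∀ X, D21.rho α X ∈ D21.K4') ∧
    -- `dim H¹(Γ_α, K'(4)) = 1`
    Module.finrank ℂ (D21.H1 (D21.gammaAlpha α) D21.poisson (D21.rho α) D21.K4') = 1 ∧
    -- `θ` is an even 1-cocycle with values in `K'(4)`, and its class spans the cohomology
    D21.theta ∈ D21.cocyclesOfParity (D21.gammaAlpha α) D21.poisson (D21.rho α) D21.K4' 0 ∧
    (∃ hθ : D21.theta ∈ D21.Z1 (D21.gammaAlpha α) D21.poisson (D21.rho α) D21.K4',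
      Submodule.span ℂ {(Submodule.Quotient.mk ⟨D21.theta, hθ⟩ :
        D21.H1 (D21.gammaAlpha α) D21.poisson (D21.rho α) D21.K4')} = ⊤) ∧
    -- `θ = dc₃`
    (∀ X, D21.theta X = D21.poisson.br (D21.rho α X) D21.c3) ∧
    -- the cup product `[[θ, θ]]` vanishes identically
    (∀ X Y, D21.cup D21.poisson D21.theta D21.theta X Y = 0) ∧
    -- `ρ_α + βθ` is a formal deformation of `ρ_α`, and a homomorphism for every number `β`
    D21.IsFormalDeformation (D21.gammaAlpha α) D21.poisson D21.K4' (D21.rho α)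
      (fun k => if k = 0 then D21.rho α else if k = 1 then D21.theta else 0) ∧
    (∀ β : ℂ, D21.IsSuperHom (D21.gammaAlpha α) D21.poisson (D21.rho α + β • D21.theta)) := by
  refine ⟨⟨⟨D21.hasParity_rho α, D21.rho_br α⟩, D21.rho_injective α, D21.rho_mem α⟩, ?_,
    D21.theta_mem_cocycles α, ⟨D21.theta_mem_Z1 α, ?_⟩, D21.theta_eq_br_c3 α, fun X Y => ?_,
    D21.isFormalDeformation_rho_theta α, D21.isSuperHom_rho_add_smul_theta α⟩
  · exact finrank_eq_one (D21.thetaClass α) (D21.thetaClass_ne_zero α)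
      (D21.exists_smul_thetaClass_eq α)
  · exact (Submodule.span_singleton_eq_top_iff ℂ _).2 (D21.exists_smul_thetaClass_eq α)
  · rw [D21.cup, D21.br_theta_theta, add_zero]
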